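/- Let $\mathfrak g$ be a complex Lie algebra (of arbitrary dimension) acting by derivations on a unital associative $\mathbb C$-algebra $A$, and regard $A$ as a $U(\mathfrak g)$-module algebra, where $U(\mathfrak g)$ is the universal enveloping algebra with its standard bialgebra structure (elements of $\mathfrak g$ are primitive). Let $A\mathbin{\#}U(\mathfrak g)$ be the smash product, i.e. $A\otimes U(\mathfrak g)$ with multiplication $(a\otimes h)(b\otimes k)=\sum a\,(h_{(1)}\cdot b)\otimes h_{(2)}k$. For an algebra $B$ let $\widehat B$ denote its Arens-Michael envelope, i.e. the (Hausdorff) completion of $B$ with respect to the family of all submultiplicative seminorms on $B$; write $\widehat U(\mathfrak g)=\widehat{U(\mathfrak g)}$. Let $\widetilde A$ be the (Hausdorff) completion of $A$ with respect to the family of all submultiplicative seminorms $\|\cdot\|$ on $A$ that are $U(\mathfrak g)$-stable, i.e. such that for each $h\in U(\mathfrak g)$ there is $C>0$ with $\|h\cdot a\|\le C\|a\|$ for all $a\in A$. The comultiplication of $U(\mathfrak g)$ and its action on $A$ extend by continuity to $\widehat U(\mathfrak g)\to\widehat U(\mathfrak g)\mathbin{\widehat\otimes}\widehat U(\mathfrak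 g)$ and $\widehat U(\mathfrak g)\mathbin{\widehat\otimes}\widetilde A\to\widetilde A$, where $\widehat\otimes$ is the completed projective tensor product. Let $\widetilde A\mathbin{\widehat{\#}}\widehat U(\mathfrak g)$ be the analytic smash product, i.e. the space $\widetilde A\mathbin{\widehat\otimes}\widehat U(\mathfrak g)$ with the multiplication defined by the same formulas as for the algebraic smash product, with $\otimes$ replaced by $\widehat\otimes$. Then the canonical homomorphism $A\mathbin{\#}U(\mathfrak g)\to\widetilde A\mathbin{\widehat{\#}}\widehat U(\mathfrak g)$ extends to an isomorphism of $\widehat\otimes$-algebras (that is, an algebra isomorphism which is a homeomorphism) $$\bigl(A\mathbin{\#}U(\mathfrak g)\bigr)^{\widehat{\ }}\;\cong\;\widetilde A\mathbin{\widehat{\#}}\widehat U(\mathfrak g).$$ -/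

import Mathlib

open scoped TensorProduct Topology
open UniformSpace
universe u v w x
set_option linter.unusedSectionVars false

section Seminorms

variable {E : Type u} {F : Type v} {G : Type w} {Z : Type x}
  [AddCommGroup E] [Module ℂ E] [AddCommGroup F] [Module ℂ F]
  [AddCommGroup G] [Module ℂ G] [AddCommGroup Z] [Module ℂ Z]

/-- The locally convex topology on `E` generated by a set `S` of seminorms. -/
@[reducible] noncomputable def seminormTopology (S : Set (Seminorm ℂ E)) : TopologicalSpace E :=
  (SeminormFamily.moduleFilterBasis (fun p : S => (p : Seminorm ℂ E))).topology

theorem seminormTopology_withSeminorms (S : Set (Seminorm ℂ E)) :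
    @WithSeminorms ℂ E S _ _ _ (fun p : S => (p : Seminorm ℂ E)) (seminormTopology S) :=
  letI := seminormTopology S
  ⟨rfl⟩

theorem continuous_of_seminorm_comp [TopologicalSpace E] [IsTopologicalAddGroup E]
    [TopologicalSpace F] [PolynormableSpace ℂ F] (f : E →ₗ[ℂ] F)
    (h : ∀ r : Seminorm ℂ F, Continuous r → Continuous (r.comp f)) : Continuous f :=
  WithSeminorms.continuous_of_continuous_comp (PolynormableSpace.withSeminorms ℂ F) f
    (fun r => h r.1 r.2)

theorem continuous_bilin_of_bound [TopologicalSpace E] [TopologicalSpace F] [TopologicalSpace G]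
    [IsTopologicalAddGroup E] [IsTopologicalAddGroup F]
    {ι : Type*} {P : SeminormFamily ℂ G ι} (hP : WithSeminorms P) (B : E →ₗ[ℂ] F →ₗ[ℂ] G)
    (h : ∀ i, ∃ (p : Seminorm ℂ E) (q : Seminorm ℂ F),
      Continuous p ∧ Continuous q ∧ ∀ x y, P i (B x y) ≤ p x * q y) :
    Continuous fun z : E × F => B z.1 z.2 := by
  rw [continuous_iff_continuousAt]
  rintro ⟨x₀, y₀⟩
  refine (hP.tendsto_nhds _ _).2 ?_
  intro i ε hε
  obtain ⟨p, q, hp, hq, hpq⟩ := h i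
  have hc : Continuous fun z : E × F => p (z.1 - x₀) * q z.2 + p x₀ * q (z.2 - y₀) := by
    fun_prop
  have h0 := hc.tendsto (x₀, y₀)
  simp only [sub_self, map_zero, zero_mul, mul_zero, add_zero] at h0
  filter_upwards [h0.eventually (gt_mem_nhds hε)] with z hz
  refine lt_of_le_of_lt ?_ hz
  have : B z.1 z.2 - B x₀ y₀ = B (z.1 - x₀) z.2 + B x₀ (z.2 - y₀) := by simp
  rw [this]
  exact (map_add_le_add (P i) _ _).trans (add_le_add (hpq _ _) (hpq _ _))

theorem continuous_seminorm_comp_bilin [TopologicalSpace E] [TopologicalSpace F]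
    [IsTopologicalAddGroup E] [IsTopologicalAddGroup F] (B : E →ₗ[ℂ] F →ₗ[ℂ] G)
    (s : Seminorm ℂ G) (p : Seminorm ℂ E) (q : Seminorm ℂ F) (hp : Continuous p)
    (hq : Continuous q) (h : ∀ x y, s (B x y) ≤ p x * q y) :
    Continuous fun z : E × F => s (B z.1 z.2) := by
  let _ : TopologicalSpace G := seminormTopology {s}
  have hw := seminormTopology_withSeminorms {s}
  exact (hw.continuous_seminorm ⟨s, rfl⟩).comp (continuous_bilin_of_bound hw B
    (by rintro ⟨_, rfl⟩; exact ⟨p, q, hp, hq, h⟩))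

/-- A neighborhood of zero in a locally convex space contains a unit ball of a continuous
seminorm. -/
theorem exists_seminorm_ball_subset [TopologicalSpace E] [PolynormableSpace ℂ E]
    {U : Set E} (hU : U ∈ 𝓝 (0 : E)) :
    ∃ p : Seminorm ℂ E, Continuous p ∧ ∀ x, p x < 1 → x ∈ U := by
  have hw := PolynormableSpace.withSeminorms ℂ E
  obtain ⟨⟨s, r⟩, hr, hs⟩ := hw.hasBasis_zero_ball.mem_iff.1 hU
  have hc : ∀ s : Finset {p : Seminorm ℂ E // Continuous p},
      Continuous (s.sup Subtype.val : Seminorm ℂ E) := by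
    intro s
    induction s using Finset.cons_induction with
    | empty => exact (continuous_const : Continuous fun _ : E => (0 : ℝ))
    | cons a s ha ih =>
      rw [Finset.sup_cons, Seminorm.coe_sup]
      exact a.2.sup ih
  refine ⟨Real.toNNReal r⁻¹ • s.sup Subtype.val, ?_, fun x hx => hs ?_⟩
  · exact continuous_const.mul (hc s)
  · rw [Seminorm.mem_ball, sub_zero]
    have : (Real.toNNReal r⁻¹ : ℝ) *
        (s.sup Subtype.val : Seminorm ℂ E) x < 1 := hx
    rw [Real.coe_toNNReal _ (inv_pos.2 hr).le] at this
    rwa [inv_mul_lt_iff₀ hr, mul_one] at this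

theorem exists_bound_of_continuous [TopologicalSpace E] [TopologicalSpace F]
    [PolynormableSpace ℂ E] [PolynormableSpace ℂ F] (B : E →ₗ[ℂ] F →ₗ[ℂ] G) (r : Seminorm ℂ G)
    (h : Continuous fun z : E × F => r (B z.1 z.2)) :
    ∃ (p : Seminorm ℂ E) (q : Seminorm ℂ F),
      Continuous p ∧ Continuous q ∧ ∀ x y, r (B x y) ≤ p x * q y := by
  have h0 := h.tendsto (0, 0)
  simp only [map_zero] at h0
  have h1 := h0.eventually (gt_mem_nhds one_pos)
  rw [nhds_prod_eq] at h1
  obtain ⟨U, hU, V, hV, hUV⟩ := Filter.eventually_prod_iff.1 h1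
  obtain ⟨p, hp, hpU⟩ := exists_seminorm_ball_subset hU
  obtain ⟨q, hq, hqV⟩ := exists_seminorm_ball_subset hV
  refine ⟨p, q, hp, hq, fun x y => ?_⟩
  have key : ∀ a b : ℝ, p x < a → q y < b → r (B x y) ≤ a * b := by
    intro a b ha hb
    have ha0 : 0 < a := (apply_nonneg p x).trans_lt ha
    have hb0 : 0 < b := (apply_nonneg q y).trans_lt hb
    have hx : p ((a⁻¹ : ℂ) • x) < 1 := by
      rw [map_smul_eq_mul, norm_inv, Complex.norm_real, Real.norm_of_nonneg ha0.le,
        inv_mul_lt_iff₀ ha0, mul_one]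
      exact ha
    have hy : q ((b⁻¹ : ℂ) • y) < 1 := by
      rw [map_smul_eq_mul, norm_inv, Complex.norm_real, Real.norm_of_nonneg hb0.le,
        inv_mul_lt_iff₀ hb0, mul_one]
      exact hb
    have h2 : r (B ((a⁻¹ : ℂ) • x) ((b⁻¹ : ℂ) • y)) < 1 := hUV (hpU _ hx) (hqV _ hy)
    rw [map_smul (B _), map_smul B, LinearMap.smul_apply, map_smul_eq_mul, map_smul_eq_mul, norm_inv,
      norm_inv, Complex.norm_real, Complex.norm_real, Real.norm_of_nonneg ha0.le,
      Real.norm_of_nonneg hb0.le, inv_mul_lt_iff₀ hb0, inv_mul_lt_iff₀ ha0] at h2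
    linarith
  have hlim : Filter.Tendsto (fun ε : ℝ => (p x + ε) * (q y + ε)) (𝓝[>] 0)
      (𝓝 ((p x + 0) * (q y + 0))) := by
    refine Filter.Tendsto.mono_left (Continuous.tendsto (by fun_prop) 0) nhdsWithin_le_nhds
  rw [add_zero, add_zero] at hlim
  refine ge_of_tendsto hlim ?_
  filter_upwards [self_mem_nhdsWithin] with ε hε
  have hε' : (0 : ℝ) < ε := hε
  exact key _ _ (by linarith) (by linarith)

/-- The projective tensor product of two seminorms, as the largest seminorm `s` on `E ⊗ F` with
`s (x ⊗ y) ≤ p x * q y`. -/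
noncomputable def projSeminorm (p : Seminorm ℂ E) (q : Seminorm ℂ F) : Seminorm ℂ (E ⊗[ℂ] F) :=
  sSup {s | ∀ x y, s (x ⊗ₜ[ℂ] y) ≤ p x * q y}

theorem projSeminorm_bddAbove (p : Seminorm ℂ E) (q : Seminorm ℂ F) :
    BddAbove {s : Seminorm ℂ (E ⊗[ℂ] F) | ∀ x y, s (x ⊗ₜ[ℂ] y) ≤ p x * q y} := by
  have key : ∀ t : E ⊗[ℂ] F, ∃ C : ℝ, ∀ s ∈ {s : Seminorm ℂ (E ⊗[ℂ] F) |
      ∀ x y, s (x ⊗ₜ[ℂ] y) ≤ p x * q y}, s t ≤ C := by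
    intro t
    induction t using TensorProduct.induction_on with
    | zero => exact ⟨0, fun s _ => by simp⟩
    | tmul x y => exact ⟨p x * q y, fun s hs => hs x y⟩
    | add a b ha hb =>
      obtain ⟨C, hC⟩ := ha
      obtain ⟨D, hD⟩ := hb
      exact ⟨C + D, fun s hs => (map_add_le_add s a b).trans (add_le_add (hC s hs) (hD s hs))⟩
  choose C hC using key
  rw [Seminorm.bddAbove_iff]
  refine ⟨C, ?_⟩
  rintro _ ⟨s, hs, rfl⟩ t
  exact hC t s hs

theorem le_projSeminorm (p : Seminorm ℂ E) (q : Seminorm ℂ F) (s : Seminorm ℂ (E ⊗[ℂ] F))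
    (h : ∀ x y, s (x ⊗ₜ[ℂ] y) ≤ p x * q y) (t : E ⊗[ℂ] F) : s t ≤ projSeminorm p q t :=
  (le_csSup (projSeminorm_bddAbove p q) h : s ≤ projSeminorm p q) t

theorem projSeminorm_tmul_le (p : Seminorm ℂ E) (q : Seminorm ℂ F) (x : E) (y : F) :
    projSeminorm p q (x ⊗ₜ[ℂ] y) ≤ p x * q y := by
  rw [projSeminorm, Seminorm.coe_sSup_eq (projSeminorm_bddAbove p q), iSup_apply]
  have : Nonempty {s : Seminorm ℂ (E ⊗[ℂ] F) | ∀ x y, s (x ⊗ₜ[ℂ] y) ≤ p x * q y} :=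
    ⟨⟨0, fun x y => by simpa using mul_nonneg (apply_nonneg p x) (apply_nonneg q y)⟩⟩
  exact ciSup_le fun s => s.2 x y

theorem le_mul_projSeminorm (p : Seminorm ℂ E) (q : Seminorm ℂ F) (s : Seminorm ℂ (E ⊗[ℂ] F))
    (c : ℝ) (hc : 0 ≤ c) (h : ∀ x y, s (x ⊗ₜ[ℂ] y) ≤ c * (p x * q y)) (t : E ⊗[ℂ] F) :
    s t ≤ c * projSeminorm p q t := by
  obtain rfl | hc := hc.eq_or_lt
  · induction t using TensorProduct.induction_on with
    | zero => simp
    | tmul x y => simpa using h x y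
    | add a b ha hb =>
      have := map_add_le_add s a b
      linarith
  · have h2 := le_projSeminorm p q (Real.toNNReal c⁻¹ • s) (fun x y => by
      change (Real.toNNReal c⁻¹ : ℝ) * s _ ≤ _
      rw [Real.coe_toNNReal _ (inv_pos.2 hc).le, inv_mul_le_iff₀ hc]
      exact h x y) t
    change (Real.toNNReal c⁻¹ : ℝ) * s _ ≤ _ at h2
    rwa [Real.coe_toNNReal _ (inv_pos.2 hc).le, inv_mul_le_iff₀ hc] at h2

end Seminorms

section Completions

variable {E : Type u} {F : Type v} {G : Type w} {Z : Type x}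
  [AddCommGroup E] [Module ℂ E] [AddCommGroup F] [Module ℂ F]
  [AddCommGroup G] [Module ℂ G] [AddCommGroup Z] [Module ℂ Z]

/-- The extension of a continuous seminorm to the completion. -/
noncomputable def Seminorm.toCompletion [UniformSpace E] [IsUniformAddGroup E]
    [UniformContinuousConstSMul ℂ E] (p : Seminorm ℂ E) (hp : Continuous p) :
    Seminorm ℂ (Completion E) :=
  have hu : UniformContinuous p := Seminorm.uniformContinuous_of_continuousAt_zero hp.continuousAt
  have hc : Continuous (Completion.extension p) := Completion.continuous_extension
  Seminorm.of (Completion.extension p)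
    (fun x y => by
      induction x, y using Completion.induction_on₂ with
      | hp => exact isClosed_le (by fun_prop) (by fun_prop)
      | ih x y =>
        rw [← Completion.coe_add, Completion.extension_coe hu, Completion.extension_coe hu,
          Completion.extension_coe hu]
        exact map_add_le_add p x y)
    (fun a x => by
      induction x using Completion.induction_on with
      | hp => exact isClosed_eq (hc.comp (continuous_const_smul a)) (by fun_prop)
      | ih x =>
        rw [← Completion.coe_smul, Completion.extension_coe hu, Completion.extension_coe hu]
        exact map_smul_eq_mul p a x)

theorem Seminorm.toCompletion_coe [UniformSpace E] [IsUniformAddGroup E]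
    [UniformContinuousConstSMul ℂ E] (p : Seminorm ℂ E) (hp : Continuous p) (x : E) :
    p.toCompletion hp (x : Completion E) = p x :=
  Completion.extension_coe (Seminorm.uniformContinuous_of_continuousAt_zero hp.continuousAt) x

theorem Seminorm.continuous_toCompletion [UniformSpace E] [IsUniformAddGroup E]
    [UniformContinuousConstSMul ℂ E] (p : Seminorm ℂ E) (hp : Continuous p) :
    Continuous (p.toCompletion hp) :=
  (Completion.continuous_extension : Continuous (Completion.extension p))

instance Completion.polynormableSpace [UniformSpace E] [IsUniformAddGroup E]
    [UniformContinuousConstSMul ℂ E] [PolynormableSpace ℂ E] :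
    PolynormableSpace ℂ (Completion E) := by
  refine ⟨SeminormFamily.withSeminorms_of_hasBasis _ ?_⟩
  refine ⟨fun U => ⟨fun hU => ?_, ?_⟩⟩
  · obtain ⟨C, hC, hCc, hCU⟩ := exists_mem_nhds_isClosed_subset hU
    have hCE : ((↑) : E → Completion E) ⁻¹' C ∈ 𝓝 (0 : E) :=
      (Completion.continuous_coe E).continuousAt.preimage_mem_nhds
        (by rw [Completion.coe_zero]; exact hC)
    obtain ⟨p, hp, hpC⟩ := exists_seminorm_ball_subset hCE
    refine ⟨_, SeminormFamily.basisSets_singleton_mem _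
      ⟨p.toCompletion hp, p.continuous_toCompletion hp⟩ one_pos, fun x hx => hCU ?_⟩
    have hx1 : p.toCompletion hp x < 1 := by simpa [Seminorm.mem_ball] using hx
    have hcl : x ∈ closure ({y | p.toCompletion hp y < 1} ∩ Set.range ((↑) : E → Completion E)) :=
      Dense.open_subset_closure_inter Completion.denseRange_coe
        (isOpen_lt (p.continuous_toCompletion hp) continuous_const) hx1
    refine hCc.closure_subset_iff.2 ?_ hcl
    rintro _ ⟨hy, y, rfl⟩
    exact hpC y (by simpa [Seminorm.toCompletion_coe] using hy)
  · rintro ⟨V, hV, hVU⟩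
    exact Filter.mem_of_superset
      (SeminormFamily.basisSets_mem_nhds _ (fun p => p.2) V hV) hVU

/-- Joint continuity of scalar multiplication on the completion. -/
instance Completion.continuousSMul [UniformSpace E] [IsUniformAddGroup E]
    [UniformContinuousConstSMul ℂ E] [PolynormableSpace ℂ E] : ContinuousSMul ℂ (Completion E) :=
  (PolynormableSpace.withSeminorms ℂ (Completion E)).continuousSMul

section ExtendBilin

variable {E' : Type*} {F' : Type*} [AddCommGroup E'] [Module ℂ E'] [AddCommGroup F'] [Module ℂ F']
  [TopologicalSpace E] [TopologicalSpace F]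
  [TopologicalSpace E'] [IsTopologicalAddGroup E'] [ContinuousConstSMul ℂ E']
  [TopologicalSpace F'] [IsTopologicalAddGroup F'] [ContinuousConstSMul ℂ F']
  [UniformSpace Z] [IsUniformAddGroup Z] [ContinuousConstSMul ℂ Z] [CompleteSpace Z] [T2Space Z]

theorem continuous_extend_bilin {i : E →ₗ[ℂ] E'} (hi : IsDenseInducing i) {j : F →ₗ[ℂ] F'}
    (hj : IsDenseInducing j) (B : E →ₗ[ℂ] F →ₗ[ℂ] Z)
    (hB : Continuous fun z : E × F => B z.1 z.2) :
    Continuous ((hi.prodMap hj).extend fun z : E × F => B z.1 z.2) := by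
  let φ : E →+ F →+ Z :=
    { toFun := fun x => (B x).toAddMonoidHom
      map_zero' := by ext; simp
      map_add' := fun x y => by ext; simp }
  exact IsDenseInducing.extend_Z_bilin (e := i.toAddMonoidHom) (f := j.toAddMonoidHom) (φ := φ)
    hi hj hB

theorem extend_bilin_apply {i : E →ₗ[ℂ] E'} (hi : IsDenseInducing i) {j : F →ₗ[ℂ] F'}
    (hj : IsDenseInducing j) (B : E →ₗ[ℂ] F →ₗ[ℂ] Z)
    (hB : Continuous fun z : E × F => B z.1 z.2) (x : E) (y : F) :
    (hi.prodMap hj).extend (fun z : E × F => B z.1 z.2) (i x, j y) = B x y :=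
  (hi.prodMap hj).extend_eq hB (x, y)

/-- The extension of a jointly continuous bilinear map from dense subspaces. -/
noncomputable def extendBilin {i : E →ₗ[ℂ] E'} (hi : IsDenseInducing i) {j : F →ₗ[ℂ] F'}
    (hj : IsDenseInducing j) (B : E →ₗ[ℂ] F →ₗ[ℂ] Z)
    (hB : Continuous fun z : E × F => B z.1 z.2) : E' →ₗ[ℂ] F' →ₗ[ℂ] Z :=
  have hc := continuous_extend_bilin hi hj B hB
  have ha := extend_bilin_apply hi hj B hB
  LinearMap.mk₂ ℂ (fun x y => (hi.prodMap hj).extend (fun z : E × F => B z.1 z.2) (x, y))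
    (fun x x' y => by
      refine hi.dense.induction_on₂ (p := fun x x' =>
          (hi.prodMap hj).extend (fun z : E × F => B z.1 z.2) (x + x', y) =
            (hi.prodMap hj).extend (fun z : E × F => B z.1 z.2) (x, y) +
            (hi.prodMap hj).extend (fun z : E × F => B z.1 z.2) (x', y))
        (isClosed_eq (by fun_prop) (by fun_prop)) (fun x x' => ?_) x x'
      refine hj.dense.induction_on y (isClosed_eq (by fun_prop) (by fun_prop)) fun y => ?_
      rw [← map_add, ha, ha, ha, map_add, LinearMap.add_apply])
    (fun c x y => by
      refine hi.dense.induction_on x (isClosed_eq (by fun_prop) (by fun_prop)) fun x => ?_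
      refine hj.dense.induction_on y (isClosed_eq (by fun_prop) (by fun_prop)) fun y => ?_
      rw [← map_smul, ha, ha, map_smul, LinearMap.smul_apply])
    (fun x y y' => by
      refine hj.dense.induction_on₂ (p := fun y y' =>
          (hi.prodMap hj).extend (fun z : E × F => B z.1 z.2) (x, y + y') =
            (hi.prodMap hj).extend (fun z : E × F => B z.1 z.2) (x, y) +
            (hi.prodMap hj).extend (fun z : E × F => B z.1 z.2) (x, y'))
        (isClosed_eq (by fun_prop) (by fun_prop)) (fun y y' => ?_) y y'
      refine hi.dense.induction_on x (isClosed_eq (by fun_prop) (by fun_prop)) fun x => ?_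
      rw [← map_add, ha, ha, ha, map_add])
    (fun c x y => by
      refine hi.dense.induction_on x (isClosed_eq (by fun_prop) (by fun_prop)) fun x => ?_
      refine hj.dense.induction_on y (isClosed_eq (by fun_prop) (by fun_prop)) fun y => ?_
      rw [← map_smul, ha, ha, map_smul])

theorem extendBilin_continuous {i : E →ₗ[ℂ] E'} (hi : IsDenseInducing i) {j : F →ₗ[ℂ] F'}
    (hj : IsDenseInducing j) (B : E →ₗ[ℂ] F →ₗ[ℂ] Z)
    (hB : Continuous fun z : E × F => B z.1 z.2) :
    Continuous fun z : E' × F' => extendBilin hi hj B hB z.1 z.2 :=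
  continuous_extend_bilin hi hj B hB

theorem extendBilin_apply {i : E →ₗ[ℂ] E'} (hi : IsDenseInducing i) {j : F →ₗ[ℂ] F'}
    (hj : IsDenseInducing j) (B : E →ₗ[ℂ] F →ₗ[ℂ] Z)
    (hB : Continuous fun z : E × F => B z.1 z.2) (x : E) (y : F) :
    extendBilin hi hj B hB (i x) (j y) = B x y :=
  extend_bilin_apply hi hj B hB x y

end ExtendBilin

/-- The canonical linear map into the completion. -/
noncomputable def toComplₗ (E : Type u) [AddCommGroup E] [Module ℂ E] [UniformSpace E]
    [IsUniformAddGroup E] [UniformContinuousConstSMul ℂ E] : E →ₗ[ℂ] Completion E where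
  toFun := (↑)
  map_add' := Completion.coe_add
  map_smul' := fun c x => Completion.coe_smul c x

theorem toComplₗ_isDenseInducing [UniformSpace E]
    [IsUniformAddGroup E] [UniformContinuousConstSMul ℂ E] : IsDenseInducing (toComplₗ E) :=
  Completion.isDenseInducing_coe

end Completions

/-- The algebraic tensor product of two topological vector spaces, to be endowed with the
projective tensor product topology. -/
def TopTensor (E : Type u) (F : Type v) [AddCommGroup E] [Module ℂ E] [AddCommGroup F]
    [Module ℂ F] : Type (max u v) := E ⊗[ℂ] F

namespace TopTensor

variable (E : Type u) (F : Type v) [AddCommGroup E] [Module ℂ E] [AddCommGroup F] [Module ℂ F]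

noncomputable instance : AddCommGroup (TopTensor E F) := inferInstanceAs (AddCommGroup (E ⊗[ℂ] F))

noncomputable instance : Module ℂ (TopTensor E F) := inferInstanceAs (Module ℂ (E ⊗[ℂ] F))

/-- The identity map, as a linear isomorphism. -/
noncomputable def of : E ⊗[ℂ] F ≃ₗ[ℂ] TopTensor E F := LinearEquiv.refl ℂ (E ⊗[ℂ] F)

variable [TopologicalSpace E] [TopologicalSpace F]

/-- The seminorms `s` on `E ⊗ F` for which `(x, y) ↦ s (x ⊗ y)` is continuous. -/
def projSeminorms : Set (Seminorm ℂ (TopTensor E F)) :=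
  {s | Continuous fun z : E × F => s (of E F (z.1 ⊗ₜ[ℂ] z.2))}

/-- The projective tensor product topology: the finest locally convex topology for which the
canonical bilinear map is jointly continuous. -/
noncomputable instance : TopologicalSpace (TopTensor E F) := seminormTopology (projSeminorms E F)

theorem withSeminorms : WithSeminorms (fun p : projSeminorms E F => p.1) :=
  seminormTopology_withSeminorms _

instance : IsTopologicalAddGroup (TopTensor E F) := (withSeminorms E F).topologicalAddGroup

instance : ContinuousSMul ℂ (TopTensor E F) := (withSeminorms E F).continuousSMul

instance : PolynormableSpace ℂ (TopTensor E F) := (withSeminorms E F).toPolynormableSpace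

noncomputable instance : UniformSpace (TopTensor E F) :=
  IsTopologicalAddGroup.rightUniformSpace (TopTensor E F)

instance : IsUniformAddGroup (TopTensor E F) := isUniformAddGroup_of_addCommGroup

instance : UniformContinuousConstSMul ℂ (TopTensor E F) :=
  uniformContinuousConstSMul_of_continuousConstSMul ℂ (TopTensor E F)

end TopTensor

/-- The completed projective tensor product. -/
abbrev CTensor (E : Type u) (F : Type v) [AddCommGroup E] [Module ℂ E] [AddCommGroup F]
    [Module ℂ F] [TopologicalSpace E] [TopologicalSpace F] : Type (max u v) :=
  Completion (TopTensor E F)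

namespace CTensor

section Basic

variable {E : Type u} {F : Type v} {G : Type w} {Z : Type x}
  [AddCommGroup E] [Module ℂ E] [AddCommGroup F] [Module ℂ F]
  [AddCommGroup G] [Module ℂ G] [AddCommGroup Z] [Module ℂ Z]
  [TopologicalSpace E] [IsTopologicalAddGroup E] [PolynormableSpace ℂ E]
  [TopologicalSpace F] [IsTopologicalAddGroup F] [PolynormableSpace ℂ F]
  [TopologicalSpace G] [IsTopologicalAddGroup G] [PolynormableSpace ℂ G]
  [UniformSpace Z] [IsUniformAddGroup Z] [UniformContinuousConstSMul ℂ Z] [PolynormableSpace ℂ Z]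
  [CompleteSpace Z] [T2Space Z]

/-- The canonical map of the algebraic tensor product into the completed one. -/
noncomputable def ofTensor (E : Type u) (F : Type v) [AddCommGroup E] [Module ℂ E] [AddCommGroup F]
    [Module ℂ F] [TopologicalSpace E] [TopologicalSpace F] : E ⊗[ℂ] F →ₗ[ℂ] CTensor E F :=
  (toComplₗ (TopTensor E F)).comp (TopTensor.of E F).toLinearMap

/-- Elementary tensors in the completed projective tensor product. -/
noncomputable def tmul : E →ₗ[ℂ] F →ₗ[ℂ] CTensor E F :=
  (TensorProduct.mk ℂ E F).compr₂ (ofTensor E F)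

theorem ofTensor_tmul (x : E) (y : F) : ofTensor E F (x ⊗ₜ[ℂ] y) = tmul x y := rfl

theorem denseRange_ofTensor : DenseRange (ofTensor E F) :=
  Completion.denseRange_coe (α := TopTensor E F)

theorem continuous_topTensor_mk :
    Continuous fun z : E × F => TopTensor.of E F (z.1 ⊗ₜ[ℂ] z.2) := by
  exact continuous_bilin_of_bound (TopTensor.withSeminorms E F)
    ((TensorProduct.mk ℂ E F).compr₂ (TopTensor.of E F).toLinearMap) fun i =>
      exists_bound_of_continuous
        ((TensorProduct.mk ℂ E F).compr₂ (TopTensor.of E F).toLinearMap) i.1 i.2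

theorem continuous_tmul : Continuous fun z : E × F => (tmul z.1 z.2 : CTensor E F) :=
  (Completion.continuous_coe _).comp continuous_topTensor_mk

/-- A linear map on `E ⊗ F` with values in a locally convex space is continuous in the projective
topology if the corresponding bilinear map is jointly continuous. -/
theorem continuous_topTensor_lift (f : TopTensor E F →ₗ[ℂ] Z)
    (hf : Continuous fun z : E × F => f (TopTensor.of E F (z.1 ⊗ₜ[ℂ] z.2))) : Continuous f :=
  continuous_of_seminorm_comp f fun r hr =>
    (TopTensor.withSeminorms E F).continuous_seminorm ⟨r.comp f, hr.comp hf⟩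

/-- The continuous linear map on `E ⊗̂ F` induced by a jointly continuous bilinear map. -/
noncomputable def lift (B : E →ₗ[ℂ] F →ₗ[ℂ] Z) (hB : Continuous fun z : E × F => B z.1 z.2) :
    CTensor E F →L[ℂ] Z :=
  ContinuousLinearMap.fromCompletion
    ⟨(TensorProduct.lift B).comp (TopTensor.of E F).symm.toLinearMap,
      continuous_topTensor_lift _ hB⟩

theorem lift_ofTensor (B : E →ₗ[ℂ] F →ₗ[ℂ] Z) (hB : Continuous fun z : E × F => B z.1 z.2)
    (t : E ⊗[ℂ] F) : lift B hB (ofTensor E F t) = TensorProduct.lift B t :=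
  ContinuousLinearMap.fromCompletion_apply_coe
    ⟨(TensorProduct.lift B).comp (TopTensor.of E F).symm.toLinearMap,
      continuous_topTensor_lift _ hB⟩ (TopTensor.of E F t)

theorem lift_tmul (B : E →ₗ[ℂ] F →ₗ[ℂ] Z) (hB : Continuous fun z : E × F => B z.1 z.2)
    (x : E) (y : F) : lift B hB (tmul x y) = B x y :=
  (lift_ofTensor B hB _).trans (TensorProduct.lift.tmul x y)

theorem continuous_projSeminorm (p : Seminorm ℂ E) (q : Seminorm ℂ F) (hp : Continuous p)
    (hq : Continuous q) :
    Continuous ((projSeminorm p q).comp (TopTensor.of E F).symm.toLinearMap) := by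
  refine (TopTensor.withSeminorms E F).continuous_seminorm ⟨_, ?_⟩
  exact continuous_seminorm_comp_bilin (TensorProduct.mk ℂ E F) _ p q hp hq
    (projSeminorm_tmul_le p q)

/-- A jointly continuous trilinear map induces a jointly continuous bilinear map on
`(E ⊗̂ F) × G`. -/
theorem continuous_curry (Φ : E →ₗ[ℂ] F →ₗ[ℂ] G →ₗ[ℂ] Z)
    (h : ∀ r : Seminorm ℂ Z, Continuous r → ∃ (p : Seminorm ℂ E) (q : Seminorm ℂ F)
      (s : Seminorm ℂ G), Continuous p ∧ Continuous q ∧ Continuous s ∧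
        ∀ x y z, r (Φ x y z) ≤ p x * q y * s z) :
    Continuous fun z : TopTensor E F × G =>
      ((TensorProduct.lift Φ).comp (TopTensor.of E F).symm.toLinearMap) z.1 z.2 := by
  refine continuous_bilin_of_bound (PolynormableSpace.withSeminorms ℂ Z) _ ?_
  rintro ⟨r, hr⟩
  obtain ⟨p, q, s, hp, hq, hs, hb⟩ := h r hr
  refine ⟨_, s, continuous_projSeminorm p q hp hq, hs, fun t z => ?_⟩
  have := le_mul_projSeminorm p q (r.comp ((TensorProduct.lift Φ).flip z)) (s z) (apply_nonneg s z)
    (fun x y => by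
      have := hb x y z
      simp only [Seminorm.comp_apply, LinearMap.flip_apply, TensorProduct.lift.tmul]
      linarith) ((TopTensor.of E F).symm t)
  rw [mul_comm]
  exact this

variable [ContinuousSMul ℂ G]

/-- The continuous linear map on `(E ⊗̂ F) ⊗̂ G` induced by a jointly continuous trilinear map. -/
noncomputable def lift₃ (Φ : E →ₗ[ℂ] F →ₗ[ℂ] G →ₗ[ℂ] Z)
    (h : ∀ r : Seminorm ℂ Z, Continuous r → ∃ (p : Seminorm ℂ E) (q : Seminorm ℂ F)
      (s : Seminorm ℂ G), Continuous p ∧ Continuous q ∧ Continuous s ∧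
        ∀ x y z, r (Φ x y z) ≤ p x * q y * s z) : CTensor (CTensor E F) G →L[ℂ] Z :=
  lift (extendBilin (toComplₗ_isDenseInducing (E := TopTensor E F)) (j := LinearMap.id (M := G))
    ⟨Topology.IsInducing.id, denseRange_id⟩ _ (continuous_curry Φ h)) (extendBilin_continuous ..)

theorem lift₃_tmul (Φ : E →ₗ[ℂ] F →ₗ[ℂ] G →ₗ[ℂ] Z)
    (h : ∀ r : Seminorm ℂ Z, Continuous r → ∃ (p : Seminorm ℂ E) (q : Seminorm ℂ F)
      (s : Seminorm ℂ G), Continuous p ∧ Continuous q ∧ Continuous s ∧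
        ∀ x y z, r (Φ x y z) ≤ p x * q y * s z) (x : E) (y : F) (z : G) :
    lift₃ Φ h (tmul (tmul x y) z) = Φ x y z := by
  rw [lift₃, lift_tmul]
  exact (extendBilin_apply (toComplₗ_isDenseInducing (E := TopTensor E F))
    (j := LinearMap.id (M := G)) ⟨Topology.IsInducing.id, denseRange_id⟩ _
    (continuous_curry Φ h) (TopTensor.of E F (x ⊗ₜ[ℂ] y)) z).trans
    (congrArg (fun f : G →ₗ[ℂ] Z => f z) (TensorProduct.lift.tmul x y))

end Basic

section Maps

variable (E : Type u) (F : Type v) (G : Type w)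
  [AddCommGroup E] [Module ℂ E] [AddCommGroup F] [Module ℂ F] [AddCommGroup G] [Module ℂ G]
  [TopologicalSpace E] [IsTopologicalAddGroup E] [PolynormableSpace ℂ E]
  [TopologicalSpace F] [IsTopologicalAddGroup F] [PolynormableSpace ℂ F]
  [TopologicalSpace G] [IsTopologicalAddGroup G] [ContinuousSMul ℂ G] [PolynormableSpace ℂ G]

/-- The flip `E ⊗̂ F → F ⊗̂ E`. -/
noncomputable def comm : CTensor E F →L[ℂ] CTensor F E :=
  lift tmul.flip (continuous_tmul.comp continuous_swap)

theorem comm_tmul (x : E) (y : F) : comm E F (tmul x y) = tmul y x := lift_tmul _ _ x y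

/-- The trilinear map `(x, y, z) ↦ x ⊗ (y ⊗ z)`. -/
noncomputable def assocAux : E →ₗ[ℂ] F →ₗ[ℂ] G →ₗ[ℂ] CTensor E (CTensor F G) :=
  LinearMap.mk₂ ℂ (fun x y => (tmul x).comp (tmul y))
    (fun x x' y => by ext; simp) (fun c x y => by ext; simp)
    (fun x y y' => by ext; simp) (fun c x y => by ext; simp)

theorem assocAux_bound (r : Seminorm ℂ (CTensor E (CTensor F G))) (hr : Continuous r) :
    ∃ (p : Seminorm ℂ E) (q : Seminorm ℂ F) (s : Seminorm ℂ G), Continuous p ∧ Continuous q ∧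
      Continuous s ∧ ∀ x y z, r (assocAux E F G x y z) ≤ p x * q y * s z := by
  obtain ⟨p, r', hp, hr', h⟩ := exists_bound_of_continuous tmul r (hr.comp continuous_tmul)
  obtain ⟨q, s, hq, hs, h'⟩ := exists_bound_of_continuous tmul r' (hr'.comp continuous_tmul)
  refine ⟨p, q, s, hp, hq, hs, fun x y z => (h x _).trans ?_⟩
  rw [mul_assoc]
  exact mul_le_mul_of_nonneg_left (h' y z) (apply_nonneg p x)

/-- The associativity map `(E ⊗̂ F) ⊗̂ G → E ⊗̂ (F ⊗̂ G)`. -/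
noncomputable def assoc : CTensor (CTensor E F) G →L[ℂ] CTensor E (CTensor F G) :=
  lift₃ (assocAux E F G) (assocAux_bound E F G)

theorem assoc_tmul (x : E) (y : F) (z : G) :
    assoc E F G (tmul (tmul x y) z) = tmul x (tmul y z) :=
  lift₃_tmul _ _ x y z

end Maps

section Map

variable {E : Type*} {F : Type*} {E' : Type*} {F' : Type*}
  [AddCommGroup E] [Module ℂ E] [AddCommGroup F] [Module ℂ F]
  [AddCommGroup E'] [Module ℂ E'] [AddCommGroup F'] [Module ℂ F']
  [TopologicalSpace E] [IsTopologicalAddGroup E] [PolynormableSpace ℂ E]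
  [TopologicalSpace F] [IsTopologicalAddGroup F] [PolynormableSpace ℂ F]
  [TopologicalSpace E'] [IsTopologicalAddGroup E'] [PolynormableSpace ℂ E']
  [TopologicalSpace F'] [IsTopologicalAddGroup F'] [PolynormableSpace ℂ F']

/-- The map `f ⊗̂ g`. -/
noncomputable def map (f : E →L[ℂ] E') (g : F →L[ℂ] F') : CTensor E F →L[ℂ] CTensor E' F' :=
  lift (tmul.compl₁₂ f.toLinearMap g.toLinearMap)
    (continuous_tmul.comp (f.continuous.prodMap g.continuous))

theorem map_tmul (f : E →L[ℂ] E') (g : F →L[ℂ] F') (x : E) (y : F) :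
    map f g (tmul x y) = tmul (f x) (g y) := lift_tmul _ _ x y

/-- The inverse associativity map `E ⊗̂ (F ⊗̂ G) → (E ⊗̂ F) ⊗̂ G`. -/
noncomputable def assocInv (E : Type u) (F : Type v) (G : Type w)
    [AddCommGroup E] [Module ℂ E] [AddCommGroup F] [Module ℂ F] [AddCommGroup G] [Module ℂ G]
    [TopologicalSpace E] [IsTopologicalAddGroup E] [ContinuousSMul ℂ E] [PolynormableSpace ℂ E]
    [TopologicalSpace F] [IsTopologicalAddGroup F] [PolynormableSpace ℂ F]
    [TopologicalSpace G] [IsTopologicalAddGroup G] [PolynormableSpace ℂ G] :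
    CTensor E (CTensor F G) →L[ℂ] CTensor (CTensor E F) G :=
  map (comm F E) (.id ℂ G) ∘L comm G (CTensor F E) ∘L assoc G F E ∘L
    map (comm F G) (.id ℂ E) ∘L comm E (CTensor F G)

theorem assocInv_tmul [ContinuousSMul ℂ E] (x : E) (y : F) (z : E') :
    assocInv E F E' (tmul x (tmul y z)) = tmul (tmul x y) z := by
  simp [assocInv, comm_tmul, map_tmul, assoc_tmul]

end Map

end CTensor

section SmashProduct

variable {H : Type u} {A : Type v} [Ring H] [Bialgebra ℂ H] [Ring A] [Algebra ℂ A]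

/-- An action `α` of a bialgebra `H` on an algebra `A` makes `A` an `H`-module algebra if the unit
and the multiplication of `A` are morphisms of `H`-modules:
`h · 1 = ε(h) 1` and `h · (a b) = ∑ (h₁ · a) (h₂ · b)`. -/
class IsModuleAlgebra (α : H →ₐ[ℂ] Module.End ℂ A) : Prop where
  act_one : ∀ h : H, α h 1 = Coalgebra.counit (R := ℂ) h • (1 : A)
  act_mul : ∀ (h : H) (a b : A), α h (a * b) = LinearMap.mul' ℂ A
    (TensorProduct.map (α.toLinearMap.flip a) (α.toLinearMap.flip b)
      (Coalgebra.comul (R := ℂ) h))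

/-- The underlying vector space `A ⊗ H` of the smash product of `A` with `H` with respect to an
action `α` of `H` on `A`. -/
def SmashProduct (_α : H →ₐ[ℂ] Module.End ℂ A) : Type (max v u) := A ⊗[ℂ] H

namespace SmashProduct

variable (α : H →ₐ[ℂ] Module.End ℂ A)

noncomputable instance : AddCommGroup (SmashProduct α) := inferInstanceAs (AddCommGroup (A ⊗[ℂ] H))

noncomputable instance : Module ℂ (SmashProduct α) := inferInstanceAs (Module ℂ (A ⊗[ℂ] H))

/-- The identity map, as a linear isomorphism. -/
noncomputable def of : A ⊗[ℂ] H ≃ₗ[ℂ] SmashProduct α := LinearEquiv.refl ℂ (A ⊗[ℂ] H)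

/-- The action map `H ⊗ A → A`. -/
noncomputable def actMap : H ⊗[ℂ] A →ₗ[ℂ] A := TensorProduct.lift α.toLinearMap

/-- The map `τ : H ⊗ A → A ⊗ H`, `h ⊗ a ↦ ∑ (h₁ · a) ⊗ h₂`. -/
noncomputable def tau : H ⊗[ℂ] A →ₗ[ℂ] A ⊗[ℂ] H :=
  TensorProduct.map (actMap α) LinearMap.id ∘ₗ
    (TensorProduct.assoc ℂ H A H).symm.toLinearMap ∘ₗ
    TensorProduct.map LinearMap.id (TensorProduct.comm ℂ H A).toLinearMap ∘ₗ
    (TensorProduct.assoc ℂ H H A).toLinearMap ∘ₗ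
    TensorProduct.map (Coalgebra.comul (R := ℂ)) LinearMap.id

/-- The multiplication map `(A ⊗ H) ⊗ (A ⊗ H) → A ⊗ H` of the smash product, the composition of
`1 ⊗ τ ⊗ 1` and `μ_A ⊗ μ_H`. -/
noncomputable def mulMap : (A ⊗[ℂ] H) ⊗[ℂ] (A ⊗[ℂ] H) →ₗ[ℂ] A ⊗[ℂ] H :=
  TensorProduct.map (LinearMap.mul' ℂ A) (LinearMap.mul' ℂ H) ∘ₗ
    (TensorProduct.assoc ℂ A A (H ⊗[ℂ] H)).symm.toLinearMap ∘ₗ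
    TensorProduct.map LinearMap.id ((TensorProduct.assoc ℂ A H H).toLinearMap ∘ₗ
      TensorProduct.map (tau α) LinearMap.id ∘ₗ (TensorProduct.assoc ℂ H A H).symm.toLinearMap) ∘ₗ
    (TensorProduct.assoc ℂ A H (A ⊗[ℂ] H)).toLinearMap

theorem tau_tmul (h : H) (a : A) : tau α (h ⊗ₜ[ℂ] a) =
    TensorProduct.map (α.toLinearMap.flip a) LinearMap.id (Coalgebra.comul (R := ℂ) h) := by
  simp only [tau, LinearMap.comp_apply, TensorProduct.map_tmul, LinearMap.id_apply,
    LinearEquiv.coe_coe]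
  induction Coalgebra.comul (R := ℂ) h using TensorProduct.induction_on with
  | zero => simp
  | tmul x y => simp [actMap]
  | add x y hx hy => simp only [TensorProduct.add_tmul, map_add, hx, hy]

theorem mulMap_tmul (a b : A) (h k : H) : mulMap α ((a ⊗ₜ[ℂ] h) ⊗ₜ[ℂ] (b ⊗ₜ[ℂ] k)) =
    TensorProduct.map (LinearMap.mulLeft ℂ a) (LinearMap.mulRight ℂ k) (tau α (h ⊗ₜ[ℂ] b)) := by
  simp only [mulMap, LinearMap.comp_apply, TensorProduct.map_tmul, LinearMap.id_apply,
    LinearEquiv.coe_coe, TensorProduct.assoc_tmul, TensorProduct.assoc_symm_tmul]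
  induction tau α (h ⊗ₜ[ℂ] b) using TensorProduct.induction_on with
  | zero => simp
  | tmul x y => simp
  | add x y hx hy => simp only [TensorProduct.add_tmul, TensorProduct.tmul_add, map_add, hx, hy]

/-- Left multiplication by `1 ⊗ h`, as an algebra homomorphism `H → End (A ⊗ H)`. -/
noncomputable def leftH : H →ₐ[ℂ] Module.End ℂ (A ⊗[ℂ] H) :=
  ((Module.endTensorEndAlgHom (R := ℂ) (S := ℂ) (A := ℂ) (M := A) (N := H)).comp
    (Algebra.TensorProduct.map α (Algebra.lmul ℂ H))).comp (Bialgebra.comulAlgHom ℂ H)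

theorem leftH_tmul (h : H) (b : A) (k : H) : leftH α h (b ⊗ₜ[ℂ] k) =
    TensorProduct.map (α.toLinearMap.flip b) (LinearMap.mulRight ℂ k)
      (Coalgebra.comul (R := ℂ) h) := by
  simp only [leftH, AlgHom.comp_apply, Bialgebra.comulAlgHom_apply]
  induction Coalgebra.comul (R := ℂ) h using TensorProduct.induction_on with
  | zero => simp
  | tmul x y =>
    rw [Algebra.TensorProduct.map_tmul]
    rfl
  | add x y hx hy => simp only [map_add, LinearMap.add_apply, hx, hy]

/-- Left multiplication by `a ⊗ 1`, as an algebra homomorphism `A → End (A ⊗ H)`. -/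
noncomputable def leftA : A →ₐ[ℂ] Module.End ℂ (A ⊗[ℂ] H) :=
  (Module.endTensorEndAlgHom (R := ℂ) (S := ℂ) (A := ℂ) (M := A) (N := H)).comp
    (Algebra.TensorProduct.includeLeft.comp (Algebra.lmul ℂ A))

theorem leftA_tmul (a b : A) (k : H) : leftA a (b ⊗ₜ[ℂ] k) = (a * b) ⊗ₜ[ℂ] k := rfl

theorem mulMap_eq (a : A) (h : H) (y : A ⊗[ℂ] H) :
    mulMap α ((a ⊗ₜ[ℂ] h) ⊗ₜ[ℂ] y) = leftA a (leftH α h y) := by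
  induction y using TensorProduct.induction_on with
  | zero => simp
  | tmul b k =>
    rw [mulMap_tmul, tau_tmul, leftH_tmul]
    induction Coalgebra.comul (R := ℂ) h using TensorProduct.induction_on with
    | zero => simp
    | tmul x y => simp [leftA_tmul]
    | add x y hx hy => simp only [map_add, hx, hy]
  | add x y hx hy => simp only [TensorProduct.tmul_add, map_add, hx, hy]

/-- The map `u ⊗ v ↦ (u · a ⊗ 1) f(v)`. -/
noncomputable def twist {V : Type*} [AddCommGroup V] [Module ℂ V] (a : A)
    (f : V →ₗ[ℂ] A ⊗[ℂ] H) : H ⊗[ℂ] V →ₗ[ℂ] A ⊗[ℂ] H :=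
  TensorProduct.lift (LinearMap.mk₂ ℂ (fun u v => leftA (α u a) (f v))
    (fun u u' v => by simp) (fun c u v => by simp)
    (fun u v v' => by simp) (fun c u v => by simp))

theorem twist_tmul {V : Type*} [AddCommGroup V] [Module ℂ V] (a : A)
    (f : V →ₗ[ℂ] A ⊗[ℂ] H) (u : H) (v : V) : twist α a f (u ⊗ₜ[ℂ] v) = leftA (α u a) (f v) := rfl

theorem leftH_leftA [IsModuleAlgebra α] (h : H) (a : A) (y : A ⊗[ℂ] H) :
    leftH α h (leftA a y) =
      twist α a ((leftH α).toLinearMap.flip y) (Coalgebra.comul (R := ℂ) h) := by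
  induction y using TensorProduct.induction_on with
  | zero =>
    induction Coalgebra.comul (R := ℂ) h using TensorProduct.induction_on with
    | zero => simp
    | tmul u v => simp [twist_tmul]
    | add x y hx hy => rw [map_add, ← hx, ← hy]; simp
  | tmul b k =>
    let f := TensorProduct.map (α.toLinearMap.flip b) (LinearMap.mulRight ℂ k)
    have h1 : ∀ t : H ⊗[ℂ] H, twist α a ((leftH α).toLinearMap.flip (b ⊗ₜ[ℂ] k)) t =
        twist α a f (LinearMap.lTensor H (Coalgebra.comul (R := ℂ)) t) := by
      intro t
      induction t using TensorProduct.induction_on with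
      | zero => simp
      | tmul u v =>
        rw [LinearMap.lTensor_tmul, twist_tmul, twist_tmul]
        exact congrArg _ (leftH_tmul α v b k)
      | add x y hx hy => simp only [map_add, hx, hy]
    have h2 : ∀ t : H ⊗[ℂ] H, TensorProduct.map (α.toLinearMap.flip (a * b))
        (LinearMap.mulRight ℂ k) t = twist α a f (TensorProduct.assoc ℂ H H H
          (LinearMap.rTensor H (Coalgebra.comul (R := ℂ)) t)) := by
      intro t
      induction t using TensorProduct.induction_on with
      | zero => simp
      | tmul u v =>
        rw [LinearMap.rTensor_tmul, TensorProduct.map_tmul, LinearMap.flip_apply,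
          AlgHom.toLinearMap_apply, IsModuleAlgebra.act_mul]
        induction Coalgebra.comul (R := ℂ) u using TensorProduct.induction_on with
        | zero => simp
        | tmul x y => simp [twist_tmul, f, leftA_tmul]
        | add x y hx hy => simp only [TensorProduct.add_tmul, map_add, hx, hy]
      | add x y hx hy => simp only [map_add, hx, hy]
    rw [leftA_tmul, leftH_tmul, h1, h2, Coalgebra.coassoc_apply]
  | add x y hx hy =>
    rw [map_add, map_add, hx, hy, ← LinearMap.add_apply]
    congr 1
    ext u v
    simp [twist_tmul]

theorem mulMap_assoc [IsModuleAlgebra α] (x y z : A ⊗[ℂ] H) :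
    mulMap α (mulMap α (x ⊗ₜ[ℂ] y) ⊗ₜ[ℂ] z) = mulMap α (x ⊗ₜ[ℂ] mulMap α (y ⊗ₜ[ℂ] z)) := by
  induction x using TensorProduct.induction_on with
  | zero => simp
  | add x x' hx hx' => simp only [TensorProduct.add_tmul, map_add, hx, hx']
  | tmul a h =>
    induction y using TensorProduct.induction_on with
    | zero => simp
    | add y y' hy hy' => simp only [TensorProduct.add_tmul, TensorProduct.tmul_add, map_add, hy, hy']
    | tmul b k =>
      rw [mulMap_eq, mulMap_eq, mulMap_eq α b k, leftH_leftA, leftH_tmul]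
      induction Coalgebra.comul (R := ℂ) h using TensorProduct.induction_on with
      | zero => simp
      | tmul u v =>
        simp [leftA_tmul, twist_tmul, mulMap_eq]
      | add u v hu hv => simp only [TensorProduct.add_tmul, map_add, hu, hv]

theorem one_mulMap (y : A ⊗[ℂ] H) : mulMap α ((1 ⊗ₜ[ℂ] 1) ⊗ₜ[ℂ] y) = y := by
  rw [mulMap_eq, map_one, map_one]; rfl

theorem mulMap_one [IsModuleAlgebra α] (x : A ⊗[ℂ] H) : mulMap α (x ⊗ₜ[ℂ] (1 ⊗ₜ[ℂ] 1)) = x := by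
  induction x using TensorProduct.induction_on with
  | zero => simp
  | add x x' hx hx' => simp only [TensorProduct.add_tmul, map_add, hx, hx']
  | tmul a h =>
    have key : ∀ t : H ⊗[ℂ] H, TensorProduct.map (α.toLinearMap.flip (1 : A))
        (LinearMap.mulRight ℂ (1 : H)) t = (1 : A) ⊗ₜ[ℂ] TensorProduct.lid ℂ H
          (LinearMap.rTensor H (Coalgebra.counit (R := ℂ)) t) := by
      intro t
      induction t using TensorProduct.induction_on with
      | zero => simp
      | tmul u v => simp [IsModuleAlgebra.act_one, TensorProduct.smul_tmul]
      | add u v hu hv => simp only [TensorProduct.tmul_add, map_add, hu, hv]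
    rw [mulMap_eq, leftH_tmul, key, Coalgebra.rTensor_counit_comul]
    simp [leftA_tmul]

noncomputable instance : Mul (SmashProduct α) :=
  ⟨fun x y => of α (mulMap α ((of α).symm x ⊗ₜ[ℂ] (of α).symm y))⟩

noncomputable instance : One (SmashProduct α) := ⟨of α (1 ⊗ₜ[ℂ] 1)⟩

theorem mul_def (x y : SmashProduct α) :
    x * y = of α (mulMap α ((of α).symm x ⊗ₜ[ℂ] (of α).symm y)) := rfl

theorem one_def : (1 : SmashProduct α) = of α (1 ⊗ₜ[ℂ] 1) := rfl

noncomputable instance [IsModuleAlgebra α] : Ring (SmashProduct α) where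
  __ := (inferInstance : AddCommGroup (SmashProduct α))
  mul_assoc x y z := mulMap_assoc α ((of α).symm x) ((of α).symm y) ((of α).symm z)
  one_mul x := one_mulMap α ((of α).symm x)
  mul_one x := mulMap_one α ((of α).symm x)
  left_distrib x y z := by simp only [mul_def, map_add, TensorProduct.tmul_add]
  right_distrib x y z := by simp only [mul_def, map_add, TensorProduct.add_tmul]
  zero_mul x := by simp only [mul_def, map_zero, TensorProduct.zero_tmul]
  mul_zero x := by simp only [mul_def, map_zero, TensorProduct.tmul_zero]

noncomputable instance [IsModuleAlgebra α] : Algebra ℂ (SmashProduct α) :=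
  Algebra.ofModule
    (fun r x y => by simp only [mul_def, map_smul, ← TensorProduct.smul_tmul'])
    (fun r x y => by simp only [mul_def, map_smul, TensorProduct.tmul_smul])

end SmashProduct

end SmashProduct

namespace UniversalEnvelopingAlgebra

variable (𝔤 : Type u) [LieRing 𝔤] [LieAlgebra ℂ 𝔤]

section

attribute [local instance] LieRing.ofAssociativeRing

/-- The comultiplication of `U(𝔤)`, given by `x ↦ x ⊗ 1 + 1 ⊗ x` on `𝔤`. -/
noncomputable def comulHom : UniversalEnvelopingAlgebra ℂ 𝔤 →ₐ[ℂ]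
    UniversalEnvelopingAlgebra ℂ 𝔤 ⊗[ℂ] UniversalEnvelopingAlgebra ℂ 𝔤 :=
  lift ℂ
    { toFun := fun x => ι ℂ x ⊗ₜ[ℂ] 1 + 1 ⊗ₜ[ℂ] ι ℂ x
      map_add' := fun x y => by
        rw [map_add, TensorProduct.add_tmul, TensorProduct.tmul_add]; abel
      map_smul' := fun c x => by
        rw [map_smul, RingHom.id_apply, smul_add, TensorProduct.smul_tmul',
          TensorProduct.tmul_smul]
      map_lie' := fun {x y} => by
        simp only [LieHom.map_lie, LieRing.of_associative_ring_bracket, TensorProduct.sub_tmul,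
          TensorProduct.tmul_sub, mul_add, add_mul, Algebra.TensorProduct.tmul_mul_tmul, mul_one,
          one_mul]
        abel }

/-- The counit of `U(𝔤)`, vanishing on `𝔤`. -/
noncomputable def counitHom : UniversalEnvelopingAlgebra ℂ 𝔤 →ₐ[ℂ] ℂ := lift ℂ 0

theorem comulHom_ι (x : 𝔤) : comulHom 𝔤 (ι ℂ x) = ι ℂ x ⊗ₜ[ℂ] 1 + 1 ⊗ₜ[ℂ] ι ℂ x :=
  lift_ι_apply ℂ _ x

theorem counitHom_ι (x : 𝔤) : counitHom 𝔤 (ι ℂ x) = 0 :=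
  lift_ι_apply ℂ _ x

theorem algHom_ext' {𝔤 : Type u} [LieRing 𝔤] [LieAlgebra ℂ 𝔤] {B : Type*} [Ring B] [Algebra ℂ B]
    {f g : UniversalEnvelopingAlgebra ℂ 𝔤 →ₐ[ℂ] B} (h : ∀ x, f (ι ℂ x) = g (ι ℂ x)) : f = g :=
  hom_ext ℂ (LieHom.ext h)

/-- The bialgebra structure of `U(𝔤)`, in which the elements of `𝔤` are primitive. -/
noncomputable instance : Bialgebra ℂ (UniversalEnvelopingAlgebra ℂ 𝔤) :=
  Bialgebra.ofAlgHom (comulHom 𝔤) (counitHom 𝔤)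
    (algHom_ext' fun x => by
      simp [-ι_apply, comulHom_ι, TensorProduct.add_tmul, TensorProduct.tmul_add,
        Algebra.TensorProduct.one_def, add_assoc])
    (algHom_ext' fun x => by
      simp [-ι_apply, comulHom_ι, counitHom_ι])
    (algHom_ext' fun x => by
      simp [-ι_apply, comulHom_ι, counitHom_ι])

theorem mem_subalgebra {𝔤 : Type u} [LieRing 𝔤] [LieAlgebra ℂ 𝔤]
    (S : Subalgebra ℂ (UniversalEnvelopingAlgebra ℂ 𝔤)) (hS : ∀ x : 𝔤, ι ℂ x ∈ S)
    (u : UniversalEnvelopingAlgebra ℂ 𝔤) : u ∈ S := by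
  let f : 𝔤 →ₗ⁅ℂ⁆ S :=
    { toFun := fun x => ⟨ι ℂ x, hS x⟩
      map_add' := fun x y => Subtype.ext (map_add (ι ℂ) x y)
      map_smul' := fun c x => Subtype.ext (map_smul (ι ℂ) c x)
      map_lie' := fun {x y} => Subtype.ext (LieHom.map_lie (ι ℂ) x y) }
  have h : S.val.comp (lift ℂ f) = AlgHom.id ℂ _ := algHom_ext' fun x => by
    rw [AlgHom.comp_apply, lift_ι_apply]; rfl
  have := (lift ℂ f u).2
  rwa [show ((lift ℂ f u : S) : UniversalEnvelopingAlgebra ℂ 𝔤) = u from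
    DFunLike.congr_fun h u] at this

end

end UniversalEnvelopingAlgebra

/-- A Lie algebra `𝔤` acts on an associative algebra `A` by derivations. -/
class ActsByDerivations (𝔤 : Type u) (A : Type v) [LieRing 𝔤] [LieAlgebra ℂ 𝔤] [Ring A]
    [Algebra ℂ A] [LieRingModule 𝔤 A] [LieModule ℂ 𝔤 A] : Prop where
  lie_mul : ∀ (x : 𝔤) (a b : A), ⁅x, a * b⁆ = ⁅x, a⁆ * b + a * ⁅x, b⁆

section EnvelopingAction

attribute [local instance] LieRing.ofAssociativeRing

variable (𝔤 : Type u) (A : Type v) [LieRing 𝔤] [LieAlgebra ℂ 𝔤] [Ring A]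
    [Algebra ℂ A] [LieRingModule 𝔤 A] [LieModule ℂ 𝔤 A]

/-- The extension to `U(𝔤)` of the action of `𝔤` on `A`. -/
noncomputable def envelopingAction : UniversalEnvelopingAlgebra ℂ 𝔤 →ₐ[ℂ] Module.End ℂ A :=
  UniversalEnvelopingAlgebra.lift ℂ (LieModule.toEnd ℂ 𝔤 A)

theorem envelopingAction_ι (x : 𝔤) (a : A) :
    envelopingAction 𝔤 A (UniversalEnvelopingAlgebra.ι ℂ x) a = ⁅x, a⁆ := by
  rw [envelopingAction, UniversalEnvelopingAlgebra.lift_ι_apply]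
  rfl

instance [ActsByDerivations 𝔤 A] : IsModuleAlgebra (envelopingAction 𝔤 A) where
  act_one h := by
    let S : Subalgebra ℂ (UniversalEnvelopingAlgebra ℂ 𝔤) :=
      { carrier := {h | envelopingAction 𝔤 A h 1 = UniversalEnvelopingAlgebra.counitHom 𝔤 h • 1}
        mul_mem' := fun {h k} hh hk => by
          simp only [Set.mem_ofPred_eq] at *
          rw [map_mul, Module.End.mul_apply, hk, map_smul, hh, map_mul, smul_smul, mul_comm]
        add_mem' := fun {h k} hh hk => by
          simp only [Set.mem_ofPred_eq] at *
          rw [map_add, LinearMap.add_apply, hh, hk, map_add, add_smul]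
        algebraMap_mem' := fun c => by
          simp only [Set.mem_ofPred_eq]
          rw [AlgHom.commutes, AlgHom.commutes]; rfl }
    refine UniversalEnvelopingAlgebra.mem_subalgebra S (fun x => ?_) h
    change envelopingAction 𝔤 A _ 1 = UniversalEnvelopingAlgebra.counitHom 𝔤 _ • 1
    rw [envelopingAction_ι, UniversalEnvelopingAlgebra.counitHom_ι, zero_smul]
    have h1 := ActsByDerivations.lie_mul x (1 : A) 1
    rw [mul_one, mul_one, one_mul] at h1
    exact left_eq_add.1 h1
  act_mul h a b := by
    let D : UniversalEnvelopingAlgebra ℂ 𝔤 →ₐ[ℂ] Module.End ℂ (A ⊗[ℂ] A) :=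
      ((Module.endTensorEndAlgHom (R := ℂ) (S := ℂ) (A := ℂ) (M := A) (N := A)).comp
        (Algebra.TensorProduct.map (envelopingAction 𝔤 A) (envelopingAction 𝔤 A))).comp
        (UniversalEnvelopingAlgebra.comulHom 𝔤)
    let S : Subalgebra ℂ (UniversalEnvelopingAlgebra ℂ 𝔤) :=
      { carrier := {h | ∀ t, envelopingAction 𝔤 A h (LinearMap.mul' ℂ A t) =
          LinearMap.mul' ℂ A (D h t)}
        mul_mem' := fun {h k} hh hk t => by
          rw [map_mul, Module.End.mul_apply, hk, hh, map_mul, Module.End.mul_apply]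
        add_mem' := fun {h k} hh hk t => by
          rw [map_add, LinearMap.add_apply, hh, hk, map_add, LinearMap.add_apply, map_add]
        algebraMap_mem' := fun c t => by
          rw [AlgHom.commutes, AlgHom.commutes]
          exact (map_smul (LinearMap.mul' ℂ A) c t).symm }
    have hD : ∀ h (a b : A), D h (a ⊗ₜ[ℂ] b) =
        TensorProduct.map ((envelopingAction 𝔤 A).toLinearMap.flip a)
          ((envelopingAction 𝔤 A).toLinearMap.flip b)
          (UniversalEnvelopingAlgebra.comulHom 𝔤 h) := by
      intro h a b
      simp only [D, AlgHom.comp_apply]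
      induction UniversalEnvelopingAlgebra.comulHom 𝔤 h using TensorProduct.induction_on with
      | zero => simp
      | tmul u v =>
        rw [Algebra.TensorProduct.map_tmul]
        rfl
      | add u v hu hv => simp only [map_add, LinearMap.add_apply, hu, hv]
    have key : h ∈ S := by
      refine UniversalEnvelopingAlgebra.mem_subalgebra S (fun x t => ?_) h
      induction t using TensorProduct.induction_on with
      | zero => simp
      | tmul a b =>
        rw [hD, UniversalEnvelopingAlgebra.comulHom_ι, LinearMap.mul'_apply, envelopingAction_ι,
          ActsByDerivations.lie_mul, map_add, map_add, TensorProduct.map_tmul,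
          TensorProduct.map_tmul, LinearMap.mul'_apply, LinearMap.mul'_apply]
        simp only [LinearMap.flip_apply, AlgHom.toLinearMap_apply, map_one, Module.End.one_apply,
          envelopingAction_ι]
      | add u v hu hv => simp only [map_add, hu, hv]
    have := key (a ⊗ₜ[ℂ] b)
    rw [hD, LinearMap.mul'_apply] at this
    exact this

end EnvelopingAction

section ArensMichael

/-- Submultiplicative seminorms on an algebra. -/
def Submultiplicative {A : Type u} [Ring A] [Algebra ℂ A] (p : Seminorm ℂ A) : Prop :=
  ∀ a b : A, p (a * b) ≤ p a * p b

theorem Submultiplicative.sup {A : Type u} [Ring A] [Algebra ℂ A] {p q : Seminorm ℂ A}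
    (hp : Submultiplicative p) (hq : Submultiplicative q) : Submultiplicative (p ⊔ q) :=
  fun a b => sup_le
    ((hp a b).trans (mul_le_mul le_sup_left le_sup_left (apply_nonneg p b)
      ((apply_nonneg p a).trans le_sup_left)))
    ((hq a b).trans (mul_le_mul le_sup_right le_sup_right (apply_nonneg q b)
      ((apply_nonneg q a).trans le_sup_right)))

theorem continuousMul_of_submultiplicative {A : Type u} [Ring A] [Algebra ℂ A]
    [TopologicalSpace A] [IsTopologicalAddGroup A] (S : Set (Seminorm ℂ A))
    (hS : ∀ p ∈ S, Submultiplicative p)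
    (hw : WithSeminorms fun p : S => (p : Seminorm ℂ A)) : ContinuousMul A :=
  ⟨continuous_bilin_of_bound hw (LinearMap.mul ℂ A) fun p =>
    ⟨p, p, hw.continuous_seminorm p, hw.continuous_seminorm p, hS p p.2⟩⟩

/-- A copy of the algebra `A`, with the topology generated by all submultiplicative seminorms. -/
def AMTop (A : Type u) : Type u := A

namespace AMTop

variable (A : Type u) [Ring A] [Algebra ℂ A]

instance : Ring (AMTop A) := inferInstanceAs (Ring A)

instance : Algebra ℂ (AMTop A) := inferInstanceAs (Algebra ℂ A)

/-- The identity map, as an algebra isomorphism. -/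
def of : A ≃ₐ[ℂ] AMTop A := AlgEquiv.refl (A₁ := A)

/-- The set of all submultiplicative seminorms. -/
def seminorms : Set (Seminorm ℂ (AMTop A)) := {p | Submultiplicative p}

noncomputable instance : TopologicalSpace (AMTop A) := seminormTopology (seminorms A)

theorem withSeminorms : WithSeminorms (fun p : seminorms A => p.1) :=
  seminormTopology_withSeminorms _

instance : IsTopologicalAddGroup (AMTop A) := (withSeminorms A).topologicalAddGroup

instance : ContinuousSMul ℂ (AMTop A) := (withSeminorms A).continuousSMul

instance : PolynormableSpace ℂ (AMTop A) := (withSeminorms A).toPolynormableSpace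

instance : ContinuousMul (AMTop A) :=
  continuousMul_of_submultiplicative _ (fun _ h => h) (withSeminorms A)

instance : IsTopologicalRing (AMTop A) where

noncomputable instance : UniformSpace (AMTop A) :=
  IsTopologicalAddGroup.rightUniformSpace (AMTop A)

instance : IsUniformAddGroup (AMTop A) := isUniformAddGroup_of_addCommGroup

instance : UniformContinuousConstSMul ℂ (AMTop A) :=
  uniformContinuousConstSMul_of_continuousConstSMul ℂ (AMTop A)

end AMTop

/-- The Arens-Michael envelope of the algebra `A`: the (Hausdorff) completion of `A` with respect
to the family of all submultiplicative seminorms. -/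
abbrev ArensMichaelEnvelope (A : Type u) [Ring A] [Algebra ℂ A] : Type u := Completion (AMTop A)

/-- The canonical homomorphism of an algebra into its Arens-Michael envelope. -/
noncomputable def ArensMichaelEnvelope.ι (A : Type u) [Ring A] [Algebra ℂ A] :
    A →ₐ[ℂ] ArensMichaelEnvelope A where
  toFun a := (AMTop.of A a : Completion (AMTop A))
  map_one' := rfl
  map_mul' a b := Completion.coe_mul (α := AMTop A) a b
  map_zero' := rfl
  map_add' a b := Completion.coe_add (α := AMTop A) a b
  commutes' c := by rfl

/-- Every continuous seminorm is dominated by a submultiplicative one. -/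
theorem AMTop.exists_le {A : Type u} [Ring A] [Algebra ℂ A] (r : Seminorm ℂ (AMTop A))
    (hr : Continuous r) : ∃ p : Seminorm ℂ (AMTop A), Submultiplicative p ∧ r ≤ p := by
  obtain ⟨s, C, -, h⟩ := Seminorm.bound_of_continuous (AMTop.withSeminorms A) r hr
  have hs : Submultiplicative (s.sup fun p : AMTop.seminorms A => p.1) := by
    clear h
    induction s using Finset.cons_induction with
    | empty => exact fun a b => by simp
    | cons p s hp ih =>
      rw [Finset.sup_cons]
      exact p.2.sup ih
  refine ⟨max C 1 • s.sup fun p : AMTop.seminorms A => p.1, fun a b => ?_, fun a => ?_⟩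
  · have h1 : (1 : ℝ) ≤ (max C 1 : NNReal) := by exact_mod_cast le_max_right C 1
    change ((max C 1 : NNReal) : ℝ) * _ ≤ ((max C 1 : NNReal) : ℝ) * _ *
      (((max C 1 : NNReal) : ℝ) * _)
    generalize ((max C 1 : NNReal) : ℝ) = M at h1
    set p := s.sup fun p : AMTop.seminorms A => p.1
    have h2 := hs a b
    have h3 : 0 ≤ p a * p b := mul_nonneg (apply_nonneg p a) (apply_nonneg p b)
    nlinarith [mul_nonneg (sub_nonneg.2 h1) h3, mul_nonneg (sub_nonneg.2 h1)
      (mul_nonneg (zero_le_one.trans h1) h3)]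
  · refine (h a).trans ?_
    change (C : ℝ) * _ ≤ ((max C 1 : NNReal) : ℝ) * _
    exact mul_le_mul_of_nonneg_right (by exact_mod_cast le_max_left C 1) (apply_nonneg _ a)

end ArensMichael

section HCompletion

variable {H : Type u} {A : Type v} [Ring H] [Algebra ℂ H] [Ring A] [Algebra ℂ A]

/-- A seminorm `p` on an `H`-module is `H`-stable if for each `h` there is `C > 0` with
`p (h · a) ≤ C * p a` for all `a`. -/
def SeminormStable (α : H →ₐ[ℂ] Module.End ℂ A) (p : Seminorm ℂ A) : Prop :=
  ∀ h : H, ∃ C : ℝ, 0 < C ∧ ∀ a : A, p (α h a) ≤ C * p a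

/-- A copy of the algebra `A`, with the topology generated by all `H`-stable submultiplicative
seminorms. -/
def StableTop (_α : H →ₐ[ℂ] Module.End ℂ A) : Type v := A

namespace StableTop

variable (α : H →ₐ[ℂ] Module.End ℂ A)

instance : Ring (StableTop α) := inferInstanceAs (Ring A)

instance : Algebra ℂ (StableTop α) := inferInstanceAs (Algebra ℂ A)

/-- The identity map, as an algebra isomorphism. -/
def of : A ≃ₐ[ℂ] StableTop α := AlgEquiv.refl (A₁ := A)

/-- The set of all `H`-stable submultiplicative seminorms. -/
def seminorms : Set (Seminorm ℂ (StableTop α)) :=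
  {p | Submultiplicative p ∧ SeminormStable α (p.comp (of α).toLinearMap)}

noncomputable instance : TopologicalSpace (StableTop α) := seminormTopology (seminorms α)

theorem withSeminorms : WithSeminorms (fun p : seminorms α => p.1) :=
  seminormTopology_withSeminorms _

instance : IsTopologicalAddGroup (StableTop α) := (withSeminorms α).topologicalAddGroup

instance : ContinuousSMul ℂ (StableTop α) := (withSeminorms α).continuousSMul

instance : PolynormableSpace ℂ (StableTop α) := (withSeminorms α).toPolynormableSpace

instance : ContinuousMul (StableTop α) :=
  continuousMul_of_submultiplicative _ (fun _ h => h.1) (withSeminorms α)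

instance : IsTopologicalRing (StableTop α) where

noncomputable instance : UniformSpace (StableTop α) :=
  IsTopologicalAddGroup.rightUniformSpace (StableTop α)

instance : IsUniformAddGroup (StableTop α) := isUniformAddGroup_of_addCommGroup

instance : UniformContinuousConstSMul ℂ (StableTop α) :=
  uniformContinuousConstSMul_of_continuousConstSMul ℂ (StableTop α)

end StableTop

/-- The `H`-completion of the algebra `A`: the (Hausdorff) completion of `A` with respect to the
family of all `H`-stable submultiplicative seminorms. -/
abbrev HCompletion (α : H →ₐ[ℂ] Module.End ℂ A) : Type v := Completion (StableTop α)

/-- The canonical homomorphism of an algebra into its `H`-completion. -/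
noncomputable def HCompletion.ι (α : H →ₐ[ℂ] Module.End ℂ A) : A →ₐ[ℂ] HCompletion α where
  toFun a := (StableTop.of α a : Completion (StableTop α))
  map_one' := rfl
  map_mul' a b := Completion.coe_mul (α := StableTop α) a b
  map_zero' := rfl
  map_add' a b := Completion.coe_add (α := StableTop α) a b
  commutes' c := by rfl

/-- The seminorm `h ↦ sup {p (h · a) | p a ≤ 1}` on `H`. -/
noncomputable def opSeminorm (α : H →ₐ[ℂ] Module.End ℂ A) (p : Seminorm ℂ A) : Seminorm ℂ H :=
  ⨆ a : {a : A // p a ≤ 1}, p.comp (α.toLinearMap.flip a)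

theorem opSeminorm_bddAbove (α : H →ₐ[ℂ] Module.End ℂ A) (p : Seminorm ℂ A)
    (hp : SeminormStable α p) :
    BddAbove (Set.range fun a : {a : A // p a ≤ 1} => p.comp (α.toLinearMap.flip a)) := by
  choose C hC h using hp
  rw [Seminorm.bddAbove_iff]
  refine ⟨C, ?_⟩
  rintro _ ⟨_, ⟨a, rfl⟩, rfl⟩ u
  exact (h u a).trans (mul_le_of_le_one_right (hC u).le a.2)

theorem le_opSeminorm (α : H →ₐ[ℂ] Module.End ℂ A) (p : Seminorm ℂ A)
    (hp : SeminormStable α p) (h : H) (a : A) : p (α h a) ≤ opSeminorm α p h * p a := by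
  have h1 : ∀ a, p a ≤ 1 → p (α h a) ≤ opSeminorm α p h := fun a ha =>
    (le_ciSup (opSeminorm_bddAbove α p hp) ⟨a, ha⟩ :
      p.comp (α.toLinearMap.flip a) ≤ opSeminorm α p) h
  obtain h0 | h0 := (apply_nonneg p a).eq_or_lt
  · obtain ⟨C, _, hC⟩ := hp h
    have := hC a
    rw [← h0, mul_zero] at this ⊢
    exact this
  · have h2 : p (((p a)⁻¹ : ℂ) • a) ≤ 1 := by
      rw [map_smul_eq_mul, norm_inv, Complex.norm_real, Real.norm_of_nonneg h0.le,
        inv_mul_cancel₀ h0.ne']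
    have h3 := h1 _ h2
    rwa [map_smul (α h), map_smul_eq_mul, norm_inv, Complex.norm_real, Real.norm_of_nonneg h0.le,
      inv_mul_le_iff₀ h0, mul_comm] at h3

theorem opSeminorm_submultiplicative (α : H →ₐ[ℂ] Module.End ℂ A) (p : Seminorm ℂ A)
    (hp : SeminormStable α p) : Submultiplicative (opSeminorm α p) := by
  intro h k
  have : Nonempty {a : A // p a ≤ 1} := ⟨⟨0, by simp⟩⟩
  rw [opSeminorm, Seminorm.iSup_apply (opSeminorm_bddAbove α p hp), ← opSeminorm]
  refine ciSup_le fun a => ?_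
  have h1 := le_opSeminorm α p hp h (α k a)
  have h2 := le_opSeminorm α p hp k a
  have h3 : opSeminorm α p k * p a ≤ opSeminorm α p k :=
    mul_le_of_le_one_right (apply_nonneg _ k) a.2
  have h4 := mul_le_mul_of_nonneg_left (h2.trans h3) (apply_nonneg (opSeminorm α p) h)
  simp only [Seminorm.comp_apply, LinearMap.flip_apply, AlgHom.toLinearMap_apply, map_mul,
    Module.End.mul_apply]
  exact h1.trans h4

/-- The action of `H` on `A`, as a bilinear map between the topologized algebras. -/
noncomputable def topAction (α : H →ₐ[ℂ] Module.End ℂ A) :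
    AMTop H →ₗ[ℂ] StableTop α →ₗ[ℂ] HCompletion α :=
  (α.toLinearMap.compr₂ (HCompletion.ι α).toLinearMap).compl₁₂ (AMTop.of H).symm.toLinearMap
    (StableTop.of α).symm.toLinearMap

theorem continuous_topAction (α : H →ₐ[ℂ] Module.End ℂ A) :
    Continuous fun z : AMTop H × StableTop α => topAction α z.1 z.2 := by
  have h : Continuous fun z : AMTop H × StableTop α => ((α.toLinearMap.compl₁₂
      (AMTop.of H).symm.toLinearMap (StableTop.of α).symm.toLinearMap).compr₂
      (StableTop.of α).toLinearMap) z.1 z.2 := by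
    refine continuous_bilin_of_bound (StableTop.withSeminorms α) _ ?_
    rintro ⟨p, hp, hs⟩
    exact ⟨(opSeminorm α (p.comp (StableTop.of α).toLinearMap)).comp
      (AMTop.of H).symm.toLinearMap, p, (AMTop.withSeminorms H).continuous_seminorm
        ⟨_, opSeminorm_submultiplicative α _ hs⟩,
      (StableTop.withSeminorms α).continuous_seminorm ⟨p, hp, hs⟩,
      fun x y => le_opSeminorm α _ hs ((AMTop.of H).symm x) ((StableTop.of α).symm y)⟩
  exact (Completion.continuous_coe _).comp h

/-- The extension to `Ĥ × Ã → Ã` of the action of `H` on `A`, as a map `Ĥ ⊗̂ Ã → Ã`. -/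
noncomputable def HCompletion.action (α : H →ₐ[ℂ] Module.End ℂ A) :
    CTensor (ArensMichaelEnvelope H) (HCompletion α) →L[ℂ] HCompletion α :=
  CTensor.lift (extendBilin (toComplₗ_isDenseInducing (E := AMTop H))
    (toComplₗ_isDenseInducing (E := StableTop α)) (topAction α) (continuous_topAction α))
    (extendBilin_continuous ..)

theorem HCompletion.action_tmul (α : H →ₐ[ℂ] Module.End ℂ A) (h : H) (a : A) :
    HCompletion.action α (CTensor.tmul (ArensMichaelEnvelope.ι H h) (HCompletion.ι α a)) =
      HCompletion.ι α (α h a) := by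
  rw [HCompletion.action, CTensor.lift_tmul]
  exact extendBilin_apply (toComplₗ_isDenseInducing (E := AMTop H))
    (toComplₗ_isDenseInducing (E := StableTop α)) (topAction α) (continuous_topAction α)
    (AMTop.of H h) (StableTop.of α a)

end HCompletion

section Comultiplication

theorem Submultiplicative.projSeminorm {A : Type u} {B : Type v} [Ring A] [Algebra ℂ A] [Ring B]
    [Algebra ℂ B] {p : Seminorm ℂ A} {q : Seminorm ℂ B} (hp : Submultiplicative p)
    (hq : Submultiplicative q) : Submultiplicative (projSeminorm p q) := by
  intro s t
  refine le_mul_projSeminorm p q ((_root_.projSeminorm p q).comp (LinearMap.mulLeft ℂ s)) _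
    (apply_nonneg _ s) (fun x y => ?_) t
  rw [mul_comm]
  refine le_mul_projSeminorm p q ((_root_.projSeminorm p q).comp
    (LinearMap.mulRight ℂ (x ⊗ₜ[ℂ] y))) _ (mul_nonneg (apply_nonneg p x) (apply_nonneg q y))
    (fun x' y' => ?_) s
  simp only [Seminorm.comp_apply, LinearMap.mulRight_apply, Algebra.TensorProduct.tmul_mul_tmul]
  refine (projSeminorm_tmul_le p q _ _).trans ((mul_le_mul (hp x' x) (hq y' y)
    (apply_nonneg q _) (mul_nonneg (apply_nonneg p x') (apply_nonneg p x))).trans (le_of_eq ?_))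
  ring

variable (H : Type u) [Ring H] [Bialgebra ℂ H]

/-- The canonical map `H ⊗ H → Ĥ ⊗̂ Ĥ`. -/
noncomputable def envelopeTensor :
    H ⊗[ℂ] H →ₗ[ℂ] CTensor (ArensMichaelEnvelope H) (ArensMichaelEnvelope H) :=
  CTensor.ofTensor (ArensMichaelEnvelope H) (ArensMichaelEnvelope H) ∘ₗ
    TensorProduct.map (ArensMichaelEnvelope.ι H).toLinearMap (ArensMichaelEnvelope.ι H).toLinearMap

/-- The comultiplication of `H`, as a map `H → Ĥ ⊗̂ Ĥ`. -/
noncomputable def topComul :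
    AMTop H →ₗ[ℂ] CTensor (ArensMichaelEnvelope H) (ArensMichaelEnvelope H) :=
  envelopeTensor H ∘ₗ Coalgebra.comul (R := ℂ) ∘ₗ (AMTop.of H).symm.toLinearMap

theorem continuous_topComul : Continuous (topComul H) := by
  refine continuous_of_seminorm_comp _ fun r hr => ?_
  obtain ⟨p, q, hp, hq, h⟩ := exists_bound_of_continuous CTensor.tmul r
    (hr.comp CTensor.continuous_tmul)
  obtain ⟨p', hp', hpp'⟩ := AMTop.exists_le (p.comp (toComplₗ (AMTop H)))
    (hp.comp (Completion.continuous_coe _))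
  obtain ⟨q', hq', hqq'⟩ := AMTop.exists_le (q.comp (toComplₗ (AMTop H)))
    (hq.comp (Completion.continuous_coe _))
  let s : Seminorm ℂ (AMTop H) := (projSeminorm (p'.comp (AMTop.of H).toLinearMap)
    (q'.comp (AMTop.of H).toLinearMap)).comp
      (Coalgebra.comul (R := ℂ) ∘ₗ (AMTop.of H).symm.toLinearMap)
  have hs : Submultiplicative s := fun a b => by
    have := Submultiplicative.projSeminorm (p := p'.comp (AMTop.of H).toLinearMap)
      (q := q'.comp (AMTop.of H).toLinearMap) hp' hq'
      (Coalgebra.comul (R := ℂ) ((AMTop.of H).symm a))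
      (Coalgebra.comul (R := ℂ) ((AMTop.of H).symm b))
    rwa [← Bialgebra.comul_mul, ← map_mul] at this
  refine Seminorm.continuous_of_le ((AMTop.withSeminorms H).continuous_seminorm ⟨s, hs⟩) ?_
  intro a
  refine le_projSeminorm (p'.comp (AMTop.of H).toLinearMap) (q'.comp (AMTop.of H).toLinearMap)
    (r.comp (envelopeTensor H)) (fun x y => ?_) _
  exact (h _ _).trans (mul_le_mul (hpp' (AMTop.of H x)) (hqq' (AMTop.of H y)) (apply_nonneg _ _)
    (apply_nonneg _ _))

/-- The comultiplication `Ĥ → Ĥ ⊗̂ Ĥ`, the extension by continuity of the one of `H`. -/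
noncomputable def ArensMichaelEnvelope.comul : ArensMichaelEnvelope H →L[ℂ]
    CTensor (ArensMichaelEnvelope H) (ArensMichaelEnvelope H) :=
  ContinuousLinearMap.fromCompletion ⟨topComul H, continuous_topComul H⟩

theorem ArensMichaelEnvelope.comul_ι (h : H) : ArensMichaelEnvelope.comul H
    (ArensMichaelEnvelope.ι H h) = envelopeTensor H (Coalgebra.comul (R := ℂ) h) :=
  ContinuousLinearMap.fromCompletion_apply_coe ⟨topComul H, continuous_topComul H⟩ (AMTop.of H h)

end Comultiplication

section AnalyticSmash

section General

variable {H : Type u} {A : Type v} [Ring H] [Algebra ℂ H] [Ring A] [Algebra ℂ A]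
  [UniformSpace H] [IsUniformAddGroup H] [IsTopologicalRing H] [UniformContinuousConstSMul ℂ H]
  [ContinuousSMul ℂ H] [PolynormableSpace ℂ H] [CompleteSpace H] [T2Space H]
  [UniformSpace A] [IsUniformAddGroup A] [IsTopologicalRing A] [UniformContinuousConstSMul ℂ A]
  [ContinuousSMul ℂ A] [PolynormableSpace ℂ A] [CompleteSpace A] [T2Space A]

/-- The multiplication `A ⊗̂ A → A` of a `⊗̂`-algebra. -/
noncomputable def CTensor.mul' (A : Type v) [Ring A] [Algebra ℂ A]
    [UniformSpace A] [IsUniformAddGroup A] [IsTopologicalRing A] [UniformContinuousConstSMul ℂ A]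
    [PolynormableSpace ℂ A] [CompleteSpace A] [T2Space A] : CTensor A A →L[ℂ] A :=
  CTensor.lift (LinearMap.mul ℂ A) continuous_mul

theorem CTensor.mul'_tmul (a b : A) : CTensor.mul' A (CTensor.tmul a b) = a * b :=
  CTensor.lift_tmul _ _ a b

/-- The underlying space `A ⊗̂ H` of the analytic smash product of a `⊗̂`-algebra `A` with a
`⊗̂`-bialgebra `H` with comultiplication `Δ`, acting on `A` by `act`. -/
def AnalyticSmash (_Δ : H →L[ℂ] CTensor H H) (_act : CTensor H A →L[ℂ] A) : Type (max v u) :=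
  CTensor A H

namespace AnalyticSmash

variable (Δ : H →L[ℂ] CTensor H H) (act : CTensor H A →L[ℂ] A)

noncomputable instance : AddCommGroup (AnalyticSmash Δ act) :=
  inferInstanceAs (AddCommGroup (CTensor A H))

noncomputable instance : Module ℂ (AnalyticSmash Δ act) := inferInstanceAs (Module ℂ (CTensor A H))

noncomputable instance : UniformSpace (AnalyticSmash Δ act) :=
  inferInstanceAs (UniformSpace (CTensor A H))

instance : IsUniformAddGroup (AnalyticSmash Δ act) :=
  inferInstanceAs (IsUniformAddGroup (CTensor A H))

instance : ContinuousSMul ℂ (AnalyticSmash Δ act) :=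
  inferInstanceAs (ContinuousSMul ℂ (CTensor A H))

instance : PolynormableSpace ℂ (AnalyticSmash Δ act) :=
  inferInstanceAs (PolynormableSpace ℂ (CTensor A H))

instance : CompleteSpace (AnalyticSmash Δ act) := inferInstanceAs (CompleteSpace (CTensor A H))

instance : T2Space (AnalyticSmash Δ act) := inferInstanceAs (T2Space (CTensor A H))

/-- The identity map, as an isomorphism of topological vector spaces. -/
noncomputable def of : CTensor A H ≃L[ℂ] AnalyticSmash Δ act :=
  ContinuousLinearEquiv.refl ℂ (CTensor A H)

/-- The map `τ : H ⊗̂ A → A ⊗̂ H`, the composition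
`H ⊗̂ A → H ⊗̂ H ⊗̂ A → H ⊗̂ A ⊗̂ H → A ⊗̂ H` of `Δ ⊗ 1`, `1 ⊗ c` and `act ⊗ 1`, where `c` is the
flip. -/
noncomputable def tau : CTensor H A →L[ℂ] CTensor A H :=
  CTensor.map act (.id ℂ H) ∘L CTensor.assocInv H A H ∘L
    CTensor.map (.id ℂ H) (CTensor.comm H A) ∘L CTensor.assoc H H A ∘L
    CTensor.map Δ (.id ℂ A)

/-- The multiplication map `(A ⊗̂ H) ⊗̂ (A ⊗̂ H) → A ⊗̂ H` of the analytic smash product, the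
composition of `1 ⊗ τ ⊗ 1` and `μ_A ⊗ μ_H`. -/
noncomputable def mulMap : CTensor (CTensor A H) (CTensor A H) →L[ℂ] CTensor A H :=
  CTensor.map (CTensor.mul' A) (CTensor.mul' H) ∘L CTensor.assocInv A A (CTensor H H) ∘L
    CTensor.map (.id ℂ A) (CTensor.assoc A H H ∘L CTensor.map (tau Δ act) (.id ℂ H) ∘L
      CTensor.assocInv H A H) ∘L
    CTensor.assoc A H (CTensor A H)

theorem mulMap_tmul (a b : A) (h k : H) :
    mulMap Δ act (CTensor.tmul (CTensor.tmul a h) (CTensor.tmul b k)) =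
      CTensor.map (CTensor.mul' A) (CTensor.mul' H) (CTensor.assocInv A A (CTensor H H)
        (CTensor.tmul a (CTensor.assoc A H H
          (CTensor.tmul (tau Δ act (CTensor.tmul h b)) k)))) := by
  rw [mulMap, ContinuousLinearMap.comp_apply, ContinuousLinearMap.comp_apply,
    ContinuousLinearMap.comp_apply, CTensor.assoc_tmul, CTensor.map_tmul,
    ContinuousLinearMap.id_apply, ContinuousLinearMap.comp_apply, ContinuousLinearMap.comp_apply,
    CTensor.assocInv_tmul, CTensor.map_tmul, ContinuousLinearMap.id_apply]

noncomputable instance : Mul (AnalyticSmash Δ act) :=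
  ⟨fun x y => of Δ act (mulMap Δ act (CTensor.tmul ((of Δ act).symm x) ((of Δ act).symm y)))⟩

noncomputable instance : One (AnalyticSmash Δ act) := ⟨of Δ act (CTensor.tmul 1 1)⟩

theorem mul_def (x y : AnalyticSmash Δ act) : x * y =
    of Δ act (mulMap Δ act (CTensor.tmul ((of Δ act).symm x) ((of Δ act).symm y))) := rfl

theorem one_def : (1 : AnalyticSmash Δ act) = of Δ act (CTensor.tmul 1 1) := rfl

instance : ContinuousMul (AnalyticSmash Δ act) :=
  ⟨(of Δ act).continuous.comp ((mulMap Δ act).continuous.comp (CTensor.continuous_tmul.comp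
    (((of Δ act).symm.continuous.comp continuous_fst).prodMk
      ((of Δ act).symm.continuous.comp continuous_snd))))⟩

end AnalyticSmash

end General

variable {H : Type u} {A : Type v} [Ring H] [Bialgebra ℂ H] [Ring A] [Algebra ℂ A]
  (α : H →ₐ[ℂ] Module.End ℂ A)

/-- The analytic smash product `Ã #̂ Ĥ` of the `H`-completion of `A` with the Arens-Michael
envelope of `H`. -/
abbrev EnvelopeSmash : Type (max v u) :=
  AnalyticSmash (ArensMichaelEnvelope.comul H) (HCompletion.action α)

namespace EnvelopeSmash

/-- The canonical map `A ⊗ H → Ã ⊗̂ Ĥ`. -/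
noncomputable def tensorMap :
    A ⊗[ℂ] H →ₗ[ℂ] CTensor (HCompletion α) (ArensMichaelEnvelope H) :=
  CTensor.ofTensor (HCompletion α) (ArensMichaelEnvelope H) ∘ₗ
    TensorProduct.map (HCompletion.ι α).toLinearMap (ArensMichaelEnvelope.ι H).toLinearMap

theorem tensorMap_tmul (a : A) (h : H) : tensorMap α (a ⊗ₜ[ℂ] h) =
    CTensor.tmul (HCompletion.ι α a) (ArensMichaelEnvelope.ι H h) := rfl

theorem denseRange_tensorMap : DenseRange (tensorMap α) := by
  have h1 : ∀ x y, (CTensor.tmul x y : CTensor (HCompletion α) (ArensMichaelEnvelope H)) ∈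
      (LinearMap.range (tensorMap α)).topologicalClosure := by
    intro x y
    have hd : DenseRange (Prod.map (HCompletion.ι α) (ArensMichaelEnvelope.ι H)) :=
      (Completion.denseRange_coe (α := StableTop α)).prodMap
        (Completion.denseRange_coe (α := AMTop H))
    refine hd.induction_on (p := fun z : HCompletion α × ArensMichaelEnvelope H =>
      CTensor.tmul z.1 z.2 ∈ (LinearMap.range (tensorMap α)).topologicalClosure) (x, y)
      ((Submodule.isClosed_topologicalClosure _).preimage CTensor.continuous_tmul) fun z => ?_
    exact Submodule.le_topologicalClosure _ ⟨z.1 ⊗ₜ[ℂ] z.2, rfl⟩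
  have h2 : ∀ t, CTensor.ofTensor (HCompletion α) (ArensMichaelEnvelope H) t ∈
      (LinearMap.range (tensorMap α)).topologicalClosure := by
    intro t
    induction t using TensorProduct.induction_on with
    | zero => rw [map_zero]; exact zero_mem _
    | tmul x y => exact h1 x y
    | add x y hx hy => rw [map_add]; exact add_mem hx hy
  intro x
  have h3 : x ∈ (LinearMap.range (tensorMap α)).topologicalClosure :=
    CTensor.denseRange_ofTensor.induction_on (p := fun x =>
      x ∈ (LinearMap.range (tensorMap α)).topologicalClosure) x
      (Submodule.isClosed_topologicalClosure _) h2
  exact h3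

theorem tau_tensorMap (h : H) (a : A) :
    AnalyticSmash.tau (ArensMichaelEnvelope.comul H) (HCompletion.action α)
      (CTensor.tmul (ArensMichaelEnvelope.ι H h) (HCompletion.ι α a)) =
    tensorMap α (SmashProduct.tau α (h ⊗ₜ[ℂ] a)) := by
  rw [SmashProduct.tau_tmul]
  simp only [AnalyticSmash.tau, ContinuousLinearMap.comp_apply, CTensor.map_tmul,
    ArensMichaelEnvelope.comul_ι, ContinuousLinearMap.id_apply]
  induction Coalgebra.comul (R := ℂ) h using TensorProduct.induction_on with
  | zero => simp
  | tmul u v =>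
    change CTensor.map _ _ (CTensor.assocInv _ _ _ (CTensor.map _ _ (CTensor.assoc _ _ _
      (CTensor.tmul (CTensor.tmul (ArensMichaelEnvelope.ι H u) (ArensMichaelEnvelope.ι H v))
        (HCompletion.ι α a))))) = _
    rw [CTensor.assoc_tmul, CTensor.map_tmul, CTensor.comm_tmul, ContinuousLinearMap.id_apply,
      CTensor.assocInv_tmul, CTensor.map_tmul, HCompletion.action_tmul]
    rfl
  | add x y hx hy => simp only [map_add, LinearMap.add_apply, hx, hy]

theorem mul_tensorMap (a : A) (k : H) (t : A ⊗[ℂ] H) :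
    CTensor.map (CTensor.mul' (HCompletion α)) (CTensor.mul' (ArensMichaelEnvelope H))
      (CTensor.assocInv (HCompletion α) (HCompletion α)
        (CTensor (ArensMichaelEnvelope H) (ArensMichaelEnvelope H))
        (CTensor.tmul (HCompletion.ι α a)
          (CTensor.assoc (HCompletion α) (ArensMichaelEnvelope H) (ArensMichaelEnvelope H)
            (CTensor.tmul (tensorMap α t) (ArensMichaelEnvelope.ι H k))))) =
      tensorMap α (TensorProduct.map (LinearMap.mulLeft ℂ a) (LinearMap.mulRight ℂ k) t) := by
  induction t using TensorProduct.induction_on with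
  | zero => simp only [map_zero, LinearMap.zero_apply]
  | tmul u v =>
    rw [tensorMap_tmul, CTensor.assoc_tmul, CTensor.assocInv_tmul, CTensor.map_tmul,
      CTensor.mul'_tmul, CTensor.mul'_tmul, ← map_mul, ← map_mul]
    rfl
  | add x y hx hy => simp only [map_add, LinearMap.add_apply, hx, hy]

theorem mulMap_tensorMap (x y : A ⊗[ℂ] H) :
    AnalyticSmash.mulMap (ArensMichaelEnvelope.comul H) (HCompletion.action α)
      (CTensor.tmul (tensorMap α x) (tensorMap α y)) =
    tensorMap α (SmashProduct.mulMap α (x ⊗ₜ[ℂ] y)) := by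
  induction x using TensorProduct.induction_on with
  | zero => simp
  | add x x' hx hx' =>
    simp only [map_add, LinearMap.add_apply, TensorProduct.add_tmul, hx, hx']
  | tmul a h =>
    induction y using TensorProduct.induction_on with
    | zero => simp
    | add y y' hy hy' => simp only [map_add, TensorProduct.tmul_add, hy, hy']
    | tmul b k =>
      rw [SmashProduct.mulMap_tmul, tensorMap_tmul, tensorMap_tmul, AnalyticSmash.mulMap_tmul,
        tau_tensorMap]
      exact mul_tensorMap α a k _

/-- The canonical map `A # H → Ã #̂ Ĥ`. -/
noncomputable def canonical : SmashProduct α →ₗ[ℂ] EnvelopeSmash α :=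
  (AnalyticSmash.of _ _).toLinearEquiv.toLinearMap ∘ₗ tensorMap α ∘ₗ
    (SmashProduct.of α).symm.toLinearMap

theorem denseRange_canonical : DenseRange (canonical α) := denseRange_tensorMap α

variable [IsModuleAlgebra α]

theorem canonical_mul (x y : SmashProduct α) :
    canonical α (x * y) = canonical α x * canonical α y :=
  (mulMap_tensorMap α ((SmashProduct.of α).symm x) ((SmashProduct.of α).symm y)).symm

theorem canonical_one : canonical α 1 = 1 := rfl

noncomputable instance : Ring (EnvelopeSmash α) where
  __ := (inferInstance : AddCommGroup (EnvelopeSmash α))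
  mul_assoc x y z := by
    refine (denseRange_canonical α).induction_on₃ (isClosed_eq (by fun_prop) (by fun_prop))
      (fun x y z => ?_) x y z
    simp only [← canonical_mul, mul_assoc]
  one_mul x := by
    refine (denseRange_canonical α).induction_on x (isClosed_eq (by fun_prop) (by fun_prop))
      fun x => ?_
    rw [← canonical_one, ← canonical_mul, one_mul]
  mul_one x := by
    refine (denseRange_canonical α).induction_on x (isClosed_eq (by fun_prop) (by fun_prop))
      fun x => ?_
    rw [← canonical_one, ← canonical_mul, mul_one]
  left_distrib x y z := by simp only [AnalyticSmash.mul_def, map_add]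
  right_distrib x y z := by simp only [AnalyticSmash.mul_def, map_add, LinearMap.add_apply]
  zero_mul x := by simp only [AnalyticSmash.mul_def, map_zero, LinearMap.zero_apply]
  mul_zero x := by simp only [AnalyticSmash.mul_def, map_zero]

noncomputable instance : Algebra ℂ (EnvelopeSmash α) :=
  Algebra.ofModule
    (fun r x y => by simp only [AnalyticSmash.mul_def, map_smul, LinearMap.smul_apply])
    (fun r x y => by simp only [AnalyticSmash.mul_def, map_smul])

instance : IsTopologicalRing (EnvelopeSmash α) where

end EnvelopeSmash

end AnalyticSmash

/-! ### Dominating seminorms by submultiplicative and stable ones. -/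

section SubmultiplicativeBounds

/-! Both sides are completions of the same space `A ⊗ H`, where `H = U(𝔤)`: the left one for all
submultiplicative seminorms of `A # H`, the right one for the projective seminorms `p ⊗ q` with `p`
stable and submultiplicative on `A` and `q` submultiplicative on `H`. The theorem amounts to saying
that each family is dominated by the other.

The seminorm `p ⊗ q` need not be submultiplicative on `A # H`, but every left multiplication is
bounded for it. Left multiplication by `a ⊗ 1` costs `p a`. Left multiplication by `1 ⊗ h` sends `b
⊗ k` to `∑ (h₁ · b) ⊗ h₂ k`, a finite sum whose terms are controlled by the stability of `p` and the
submultiplicativity of `q`. A seminorm with bounded left multiplications is at most a constant times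
the operator seminorm of the left regular representation, which is submultiplicative
(`exists_submultiplicative_ge`). Only the existence of a constant for each element is needed, with
no uniformity, so the dimension of `𝔤` plays no role. This makes the canonical map continuous
(`continuous_topCanonical`).

Conversely, a submultiplicative `s` on `A # H` satisfies `s (a ⊗ h) ≤ s (a ⊗ 1) * s (1 ⊗ h)`, and
its restrictions to `A` and `H` are submultiplicative. The restriction to `A` is moreover stable: an
element `x` of `𝔤` is primitive, so in `A # U(𝔤)` it acts on `A` as the commutator with `1 ⊗ x`,
which is bounded by `2 * s (1 ⊗ x)`; and the elements of `U(𝔤)` that act boundedly form a subalgebra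
(`seminormStable_comp_includeA`). Hence the bilinear map from `A × H` to the envelope is jointly
continuous (`continuous_toEnvelopeAux`) and extends to the completed tensor product.

The two extensions are mutually inverse on the dense images of `A # H`, hence everywhere. Stability
of the restrictions is the only step special to `U(𝔤)`; the rest works for any bialgebra acting on a
module algebra. -/

theorem Submultiplicative.smul {B : Type u} [Ring B] [Algebra ℂ B] {p : Seminorm ℂ B}
    (hp : Submultiplicative p) {c : NNReal} (hc : 1 ≤ c) : Submultiplicative (c • p) := by
  intro a b
  have hc' : (1 : ℝ) ≤ c := by exact_mod_cast hc
  have hab : 0 ≤ p a * p b := mul_nonneg (apply_nonneg p a) (apply_nonneg p b)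
  change (c : ℝ) * p (a * b) ≤ (c : ℝ) * p a * ((c : ℝ) * p b)
  calc (c : ℝ) * p (a * b) ≤ c * (p a * p b) := mul_le_mul_of_nonneg_left (hp a b) c.2
    -- This is where `1 ≤ c` is needed: the right-hand side acquires two factors `c`, the left-hand
    -- side only one.
    _ ≤ c * (c * (p a * p b)) :=
      mul_le_mul_of_nonneg_left (le_mul_of_one_le_left hab hc') c.2
    _ = _ := by ring

/-- A seminorm on an algebra for which all left multiplications are bounded is dominated by a
submultiplicative one, a multiple of the operator seminorm of the left regular representation. -/
theorem exists_submultiplicative_ge {B : Type u} [Ring B] [Algebra ℂ B] (r : Seminorm ℂ B)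
    (h : ∀ x, ∃ C : ℝ, ∀ y, r (x * y) ≤ C * r y) :
    ∃ s : Seminorm ℂ B, Submultiplicative s ∧ r ≤ s := by
  -- Stability is applied to `B` acting on itself by left multiplication, so that `opSeminorm`
  -- becomes the operator seminorm of the regular representation.
  have hst : SeminormStable (Algebra.lmul ℂ B) r := fun x => by
    obtain ⟨C, hC⟩ := h x
    -- The given `C` may fail to be positive, whereas stability requires a strictly positive
    -- constant.
    exact ⟨max C 1, lt_max_of_lt_right one_pos, fun y => (hC y).trans
      (mul_le_mul_of_nonneg_right (le_max_left C 1) (apply_nonneg r y))⟩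
  -- The factor `r 1` comes from evaluating left multiplication by `x` at the unit; taking the
  -- maximum with `1` keeps the multiple submultiplicative.
  refine ⟨max (r 1).toNNReal 1 • opSeminorm (Algebra.lmul ℂ B) r,
    (opSeminorm_submultiplicative _ r hst).smul (le_max_right _ _), fun x => ?_⟩
  have h1 : r (x * 1) ≤ opSeminorm (Algebra.lmul ℂ B) r x * r 1 := le_opSeminorm _ r hst x 1
  rw [mul_one, mul_comm] at h1
  refine h1.trans ?_
  change _ ≤ ((max (r 1).toNNReal 1 : NNReal) : ℝ) * _
  exact mul_le_mul_of_nonneg_right ((Real.le_coe_toNNReal _).trans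
    (by exact_mod_cast le_max_left _ _)) (apply_nonneg _ x)

variable {H : Type u} {A : Type v} [Ring H] [Algebra ℂ H] [Ring A] [Algebra ℂ A]

theorem SeminormStable.sup {α : H →ₐ[ℂ] Module.End ℂ A} {p q : Seminorm ℂ A}
    (hp : SeminormStable α p) (hq : SeminormStable α q) : SeminormStable α (p ⊔ q) := by
  intro h
  obtain ⟨C, hC, hpC⟩ := hp h
  obtain ⟨D, hD, hqD⟩ := hq h
  refine ⟨max C D, lt_max_of_lt_left hC, fun a => sup_le ?_ ?_⟩
  · exact (hpC a).trans (mul_le_mul (le_max_left C D) le_sup_left (apply_nonneg p a)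
      (hC.le.trans (le_max_left C D)))
  · exact (hqD a).trans (mul_le_mul (le_max_right C D) le_sup_right (apply_nonneg q a)
      (hC.le.trans (le_max_left C D)))

theorem SeminormStable.smul {α : H →ₐ[ℂ] Module.End ℂ A} {p : Seminorm ℂ A}
    (hp : SeminormStable α p) (c : NNReal) : SeminormStable α (c • p) := by
  intro h
  obtain ⟨C, hC, hpC⟩ := hp h
  refine ⟨C, hC, fun a => ?_⟩
  change (c : ℝ) * p _ ≤ C * ((c : ℝ) * p a)
  rw [mul_left_comm]
  exact mul_le_mul_of_nonneg_left (hpC a) c.2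

/-- Every continuous seminorm is dominated by a stable submultiplicative one. -/
theorem StableTop.exists_le {α : H →ₐ[ℂ] Module.End ℂ A} (r : Seminorm ℂ (StableTop α))
    (hr : Continuous r) : ∃ p : Seminorm ℂ (StableTop α), Submultiplicative p ∧
      SeminormStable α (p.comp (StableTop.of α).toLinearMap) ∧ r ≤ p := by
  -- Continuity bounds `r` by `C` times a finite supremum of defining seminorms. Both defining
  -- properties survive finite suprema and scaling by a factor at least `1`, hence `max C 1` below.
  obtain ⟨s, C, -, h⟩ := Seminorm.bound_of_continuous (StableTop.withSeminorms α) r hr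
  have hs : Submultiplicative (s.sup fun p : StableTop.seminorms α => p.1) ∧
      SeminormStable α ((s.sup fun p : StableTop.seminorms α => p.1).comp
        (StableTop.of α).toLinearMap) := by
    clear h
    induction s using Finset.cons_induction with
    | empty => exact ⟨fun a b => by simp, fun h => ⟨1, one_pos, fun a => by simp⟩⟩
    | cons p s hp ih =>
      rw [Finset.sup_cons]
      exact ⟨p.2.1.sup ih.1, SeminormStable.sup p.2.2 ih.2⟩
  refine ⟨max C 1 • s.sup fun p : StableTop.seminorms α => p.1, hs.1.smul (le_max_right C 1),
    SeminormStable.smul hs.2 _, fun a => (h a).trans ?_⟩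
  change (C : ℝ) * _ ≤ ((max C 1 : NNReal) : ℝ) * _
  exact mul_le_mul_of_nonneg_right (by exact_mod_cast le_max_left C 1) (apply_nonneg _ a)

end SubmultiplicativeBounds

/-! ### Projective seminorms on `A # H`, and `A` and `H` as subalgebras. -/

namespace SmashProduct

variable {H : Type u} {A : Type v} [Ring H] [Bialgebra ℂ H] [Ring A] [Algebra ℂ A]
  (α : H →ₐ[ℂ] Module.End ℂ A)

/-- The projective seminorm is the largest one with its bound on elementary tensors, so it suffices
to compare there, where only the submultiplicativity of `p` is involved. -/
theorem projSeminorm_leftA_le {p : Seminorm ℂ A} (hp : Submultiplicative p) (q : Seminorm ℂ H)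
    (a : A) (y : A ⊗[ℂ] H) : projSeminorm p q (leftA a y) ≤ p a * projSeminorm p q y := by
  refine le_mul_projSeminorm p q ((projSeminorm p q).comp (leftA a)) (p a) (apply_nonneg p a)
    (fun b k => ?_) y
  rw [Seminorm.comp_apply, leftA_tmul, ← mul_assoc]
  exact (projSeminorm_tmul_le p q _ _).trans
    (mul_le_mul_of_nonneg_right (hp a b) (apply_nonneg q k))

/-- Writing `Δ h` as a finite sum of `u ⊗ v`, the constant can be taken to be the sum of the
products of a stability constant of `u` with `q v`. It depends on `h` alone. -/
theorem exists_projSeminorm_leftH_le {p : Seminorm ℂ A} (hp : SeminormStable α p)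
    {q : Seminorm ℂ H} (hq : Submultiplicative q) (h : H) :
    ∃ C : ℝ, 0 ≤ C ∧ ∀ y, projSeminorm p q (leftH α h y) ≤ C * projSeminorm p q y := by
  -- `Δ h` is replaced by an arbitrary tensor so that induction applies; the constant is chosen
  -- before `b` and `k`, which is what lets the bound pass to all of `A ⊗ H`.
  have key : ∀ t : H ⊗[ℂ] H, ∃ C : ℝ, 0 ≤ C ∧ ∀ b k, projSeminorm p q (TensorProduct.map
      (α.toLinearMap.flip b) (LinearMap.mulRight ℂ k) t) ≤ C * (p b * q k) := by
    intro t
    induction t using TensorProduct.induction_on with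
    | zero => exact ⟨0, le_rfl, fun b k => by simp⟩
    | tmul u v =>
      obtain ⟨D, hD, hpD⟩ := hp u
      refine ⟨D * q v, mul_nonneg hD.le (apply_nonneg q v), fun b k => ?_⟩
      rw [TensorProduct.map_tmul]
      refine (projSeminorm_tmul_le p q _ _).trans ((mul_le_mul (hpD b) (hq v k)
        (apply_nonneg q _) (mul_nonneg hD.le (apply_nonneg p b))).trans_eq (by ring))
    | add s t hs ht =>
      obtain ⟨C, hC, hs⟩ := hs
      obtain ⟨D, hD, ht⟩ := ht
      refine ⟨C + D, add_nonneg hC hD, fun b k => ?_⟩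
      rw [map_add, add_mul]
      exact (map_add_le_add _ _ _).trans (add_le_add (hs b k) (ht b k))
  obtain ⟨C, hC, hb⟩ := key (Coalgebra.comul (R := ℂ) h)
  refine ⟨C, hC, le_mul_projSeminorm p q ((projSeminorm p q).comp (leftH α h)) C hC
    fun b k => ?_⟩
  rw [Seminorm.comp_apply, leftH_tmul]
  exact hb b k

variable [IsModuleAlgebra α]

/-- The projective tensor product of a stable submultiplicative seminorm on `A` and a
submultiplicative seminorm on `H` is dominated by a submultiplicative seminorm on `A # H`. -/
theorem exists_submultiplicative_ge_projSeminorm {p : Seminorm ℂ A} (hp : Submultiplicative p)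
    (hp' : SeminormStable α p) {q : Seminorm ℂ H} (hq : Submultiplicative q) :
    ∃ s : Seminorm ℂ (SmashProduct α), Submultiplicative s ∧
      ∀ t, projSeminorm p q t ≤ s (of α t) := by
  obtain ⟨s, hs, hle⟩ := exists_submultiplicative_ge
    ((projSeminorm p q).comp (of α).symm.toLinearMap) (fun x => by
      change ∃ C : ℝ, ∀ y : A ⊗[ℂ] H, projSeminorm p q (mulMap α ((of α).symm x ⊗ₜ[ℂ] y)) ≤
        C * projSeminorm p q y
      -- Boundedness of left multiplication is preserved under sums in `x`, and for `a ⊗ h` it is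
      -- the composite of the two bounded operators `leftA a` and `leftH α h`.
      induction (of α).symm x using TensorProduct.induction_on with
      | zero => exact ⟨0, fun y => by simp⟩
      | tmul a h =>
        obtain ⟨C, -, hC⟩ := exists_projSeminorm_leftH_le α hp' hq h
        refine ⟨p a * C, fun y => ?_⟩
        rw [mulMap_eq, mul_assoc]
        exact (projSeminorm_leftA_le hp q a _).trans
          (mul_le_mul_of_nonneg_left (hC y) (apply_nonneg p a))
      | add u v hu hv =>
        obtain ⟨C, hC⟩ := hu
        obtain ⟨D, hD⟩ := hv
        refine ⟨C + D, fun y => ?_⟩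
        rw [TensorProduct.add_tmul, map_add, add_mul]
        exact (map_add_le_add _ _ _).trans (add_le_add (hC y) (hD y)))
  exact ⟨s, hs, fun t => hle (of α t)⟩

/-- The embedding of `A` into `A # H`. -/
noncomputable def includeA : A →ₗ[ℂ] SmashProduct α :=
  (of α).toLinearMap ∘ₗ (TensorProduct.mk ℂ A H).flip 1

/-- The embedding of `H` into `A # H`. -/
noncomputable def includeH : H →ₗ[ℂ] SmashProduct α :=
  (of α).toLinearMap ∘ₗ TensorProduct.mk ℂ A H 1

theorem of_tmul_mul (a : A) (h : H) (y : A ⊗[ℂ] H) :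
    of α (a ⊗ₜ[ℂ] h) * of α y = of α (leftA a (leftH α h y)) :=
  congrArg (of α) (mulMap_eq α a h y)

/-- This factorization gives `s (a ⊗ h) ≤ s (a ⊗ 1) * s (1 ⊗ h)` for every submultiplicative `s`. -/
theorem includeA_mul_includeH (a : A) (h : H) :
    includeA α a * includeH α h = of α (a ⊗ₜ[ℂ] h) := by
  refine (of_tmul_mul α a 1 (1 ⊗ₜ[ℂ] h)).trans ?_
  rw [map_one, Module.End.one_apply, leftA_tmul, mul_one]

theorem includeA_mul (a b : A) : includeA α (a * b) = includeA α a * includeA α b := by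
  refine Eq.symm ((of_tmul_mul α a 1 (b ⊗ₜ[ℂ] 1)).trans ?_)
  rw [map_one, Module.End.one_apply]
  rfl

/-- The product of `1 ⊗ h` and `1 ⊗ k` is `∑ (h₁ · 1) ⊗ h₂ k`. Since `h₁ · 1 = ε(h₁) 1`, the counit
axiom collapses the sum. -/
theorem includeH_mul (h k : H) : includeH α (h * k) = includeH α h * includeH α k := by
  refine Eq.symm ((of_tmul_mul α 1 h (1 ⊗ₜ[ℂ] k)).trans ?_)
  rw [map_one, Module.End.one_apply, leftH_tmul]
  have key : ∀ t : H ⊗[ℂ] H, TensorProduct.map (α.toLinearMap.flip (1 : A))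
      (LinearMap.mulRight ℂ k) t = (1 : A) ⊗ₜ[ℂ] (TensorProduct.lid ℂ H
        (LinearMap.rTensor H (Coalgebra.counit (R := ℂ)) t) * k) := by
    intro t
    induction t using TensorProduct.induction_on with
    | zero => simp
    | tmul u v => simp [IsModuleAlgebra.act_one, TensorProduct.smul_tmul]
    | add u v hu hv => simp only [TensorProduct.tmul_add, map_add, add_mul, hu, hv]
  rw [key, Coalgebra.rTensor_counit_comul]
  simp [includeH]

end SmashProduct

/-! ### The two continuous maps between the envelope and the analytic smash product. -/

namespace EnvelopeSmash

variable {H : Type u} {A : Type v} [Ring H] [Bialgebra ℂ H] [Ring A] [Algebra ℂ A]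
  (α : H →ₐ[ℂ] Module.End ℂ A) [IsModuleAlgebra α]

/-- The canonical homomorphism `A # H → Ã #̂ Ĥ` on `A # H` with the topology generated by all
submultiplicative seminorms. -/
noncomputable def topCanonical : AMTop (SmashProduct α) →ₐ[ℂ] EnvelopeSmash α :=
  AlgHom.ofLinearMap (canonical α ∘ₗ (AMTop.of (SmashProduct α)).symm.toLinearMap)
    (canonical_one α) (canonical_mul α)

/-- A continuous seminorm on the completed tensor product is bounded on elementary tensors by some
`p x * q y`. Enlarging `p` to a stable submultiplicative seminorm and `q` to a submultiplicative one
brings it under a projective seminorm, which a submultiplicative seminorm of `A # H` dominates. -/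
theorem continuous_topCanonical : Continuous (topCanonical α) := by
  refine continuous_of_seminorm_comp (topCanonical α).toLinearMap fun r hr => ?_
  obtain ⟨p, q, hp, hq, h⟩ := exists_bound_of_continuous CTensor.tmul
    (r.comp (AnalyticSmash.of (ArensMichaelEnvelope.comul H)
      (HCompletion.action α)).toLinearEquiv.toLinearMap)
    ((hr.comp (AnalyticSmash.of _ _).continuous).comp CTensor.continuous_tmul)
  obtain ⟨p', hp', hps, hpp'⟩ := StableTop.exists_le (p.comp (toComplₗ (StableTop α)))
    (hp.comp (Completion.continuous_coe _))
  obtain ⟨q', hq', hqq'⟩ := AMTop.exists_le (q.comp (toComplₗ (AMTop H)))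
    (hq.comp (Completion.continuous_coe _))
  obtain ⟨s, hs, hle⟩ := SmashProduct.exists_submultiplicative_ge_projSeminorm α
    (p := p'.comp (StableTop.of α).toLinearMap) (q := q'.comp (AMTop.of H).toLinearMap)
    hp' hps hq'
  refine Seminorm.continuous_of_le
    ((AMTop.withSeminorms (SmashProduct α)).continuous_seminorm ⟨s, hs⟩) fun x => ?_
  refine le_trans ?_ (hle ((SmashProduct.of α).symm x))
  -- Maximality of the projective seminorm extends the estimate from elementary tensors to all of `A
  -- ⊗ H`.
  exact le_projSeminorm _ _ (r.comp ((AnalyticSmash.of (ArensMichaelEnvelope.comul H)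
      (HCompletion.action α)).toLinearEquiv.toLinearMap ∘ₗ tensorMap α))
    (fun a k => (h _ _).trans (mul_le_mul (hpp' (StableTop.of α a)) (hqq' (AMTop.of H k))
      (apply_nonneg _ _) (apply_nonneg _ _))) _

/-- The homomorphism `(A # H)^ → Ã #̂ Ĥ` extending the canonical one. -/
noncomputable def fromEnvelope : ArensMichaelEnvelope (SmashProduct α) →A[ℂ] EnvelopeSmash α where
  __ := Completion.extensionHom (topCanonical α).toRingHom (continuous_topCanonical α)
  commutes' c := (Completion.extensionHom_coe (topCanonical α).toRingHom
    (continuous_topCanonical α) (algebraMap ℂ _ c)).trans ((topCanonical α).commutes c)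
  cont := Completion.continuous_extension

theorem fromEnvelope_ι (x : SmashProduct α) :
    fromEnvelope α (ArensMichaelEnvelope.ι _ x) = canonical α x :=
  Completion.extensionHom_coe (topCanonical α).toRingHom (continuous_topCanonical α) _

/-- The canonical bilinear map `A × H → (A # H)^`. -/
noncomputable def toEnvelopeAux :
    StableTop α →ₗ[ℂ] AMTop H →ₗ[ℂ] ArensMichaelEnvelope (SmashProduct α) :=
  ((TensorProduct.mk ℂ A H).compr₂ ((ArensMichaelEnvelope.ι (SmashProduct α)).toLinearMap ∘ₗ
    (SmashProduct.of α).toLinearMap)).compl₁₂ (StableTop.of α).symm.toLinearMap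
    (AMTop.of H).symm.toLinearMap

/-- The two seminorms bounding the bilinear map are the restrictions of one submultiplicative `s`
along the multiplicative embeddings of `A` and `H`. The hypothesis `hα` is exactly what makes the
restriction to `A` one of the seminorms defining the `H`-completion. -/
theorem continuous_toEnvelopeAux (hα : ∀ s : Seminorm ℂ (SmashProduct α), Submultiplicative s →
    SeminormStable α (s.comp (SmashProduct.includeA α))) :
    Continuous fun z : StableTop α × AMTop H => toEnvelopeAux α z.1 z.2 := by
  refine continuous_bilin_of_bound
    (PolynormableSpace.withSeminorms ℂ (ArensMichaelEnvelope (SmashProduct α))) _ ?_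
  rintro ⟨r, hr⟩
  obtain ⟨s, hs, hle⟩ := AMTop.exists_le (r.comp (toComplₗ (AMTop (SmashProduct α))))
    (hr.comp (Completion.continuous_coe _))
  let s' : Seminorm ℂ (SmashProduct α) := s.comp (AMTop.of (SmashProduct α)).toLinearMap
  have hs' : Submultiplicative s' := hs
  let p : Seminorm ℂ (StableTop α) :=
    (s'.comp (SmashProduct.includeA α)).comp (StableTop.of α).symm.toLinearMap
  let q : Seminorm ℂ (AMTop H) :=
    (s'.comp (SmashProduct.includeH α)).comp (AMTop.of H).symm.toLinearMap
  have hp : Submultiplicative p := fun a b => (congrArg s'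
    (SmashProduct.includeA_mul α ((StableTop.of α).symm a) ((StableTop.of α).symm b))).trans_le
      (hs' _ _)
  have hq : Submultiplicative q := fun h k => (congrArg s'
    (SmashProduct.includeH_mul α ((AMTop.of H).symm h) ((AMTop.of H).symm k))).trans_le (hs' _ _)
  refine ⟨p, q, (StableTop.withSeminorms α).continuous_seminorm ⟨p, hp, hα s' hs'⟩,
    (AMTop.withSeminorms H).continuous_seminorm ⟨q, hq⟩, fun a h => ?_⟩
  refine (hle (AMTop.of (SmashProduct α) (SmashProduct.of α
    ((StableTop.of α).symm a ⊗ₜ[ℂ] (AMTop.of H).symm h)))).trans ?_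
  -- Factoring `a ⊗ h` as a product in `A # H` turns the required bound into the submultiplicativity
  -- of `s'`.
  rw [← SmashProduct.includeA_mul_includeH]
  exact hs' _ _

/-- The map `Ã #̂ Ĥ → (A # H)^` induced by the canonical bilinear map `A × H → (A # H)^`. -/
noncomputable def toEnvelope (hα : ∀ s : Seminorm ℂ (SmashProduct α), Submultiplicative s →
    SeminormStable α (s.comp (SmashProduct.includeA α))) :
    EnvelopeSmash α →L[ℂ] ArensMichaelEnvelope (SmashProduct α) :=
  CTensor.lift (extendBilin (toComplₗ_isDenseInducing (E := StableTop α))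
    (toComplₗ_isDenseInducing (E := AMTop H)) (toEnvelopeAux α) (continuous_toEnvelopeAux α hα))
    (extendBilin_continuous ..) ∘L
  (AnalyticSmash.of (ArensMichaelEnvelope.comul H)
    (HCompletion.action α)).symm.toContinuousLinearMap

/-- By linearity this is a matter of elementary tensors, on which the extended bilinear map is
known. It yields both inverse identities on dense subspaces. -/
theorem toEnvelope_canonical (hα : ∀ s : Seminorm ℂ (SmashProduct α), Submultiplicative s →
    SeminormStable α (s.comp (SmashProduct.includeA α))) (x : SmashProduct α) :
    toEnvelope α hα (canonical α x) = ArensMichaelEnvelope.ι _ x := by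
  obtain ⟨t, rfl⟩ := (SmashProduct.of α).surjective x
  induction t using TensorProduct.induction_on with
  | zero => simp
  | add u v hu hv => simp only [map_add, hu, hv]
  | tmul a h =>
    exact (CTensor.lift_tmul _ (extendBilin_continuous ..) (HCompletion.ι α a)
      (ArensMichaelEnvelope.ι H h)).trans
      (extendBilin_apply (toComplₗ_isDenseInducing (E := StableTop α))
        (toComplₗ_isDenseInducing (E := AMTop H)) (toEnvelopeAux α)
        (continuous_toEnvelopeAux α hα) (StableTop.of α a) (AMTop.of H h))

/-- If every submultiplicative seminorm on `A # H` restricts to a stable seminorm on `A`, then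
`(A # H)^` is isomorphic to `Ã #̂ Ĥ`. -/
noncomputable def envelopeEquiv (hα : ∀ s : Seminorm ℂ (SmashProduct α), Submultiplicative s →
    SeminormStable α (s.comp (SmashProduct.includeA α))) :
    ArensMichaelEnvelope (SmashProduct α) ≃A[ℂ] EnvelopeSmash α where
  -- The algebra structure is carried entirely by this direction, so the inverse only has to be a
  -- continuous map, with no check of multiplicativity.
  __ := fromEnvelope α
  invFun := toEnvelope α hα
  -- In both inverse identities the two sides are continuous maps into a Hausdorff space, so
  -- agreement on the dense image of `A # H` suffices.
  left_inv x := by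
    change toEnvelope α hα (fromEnvelope α x) = x
    induction x using Completion.induction_on with
    | hp =>
      exact isClosed_eq ((toEnvelope α hα).continuous.comp (fromEnvelope α).continuous)
        continuous_id
    | ih x =>
      exact (congrArg (toEnvelope α hα) (fromEnvelope_ι α x)).trans (toEnvelope_canonical α hα x)
  right_inv x := by
    change fromEnvelope α (toEnvelope α hα x) = x
    refine (denseRange_canonical α).induction_on x
      (isClosed_eq ((fromEnvelope α).continuous.comp (toEnvelope α hα).continuous)
        continuous_id) fun x => ?_
    rw [toEnvelope_canonical, fromEnvelope_ι]
  continuous_toFun := (fromEnvelope α).continuous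
  continuous_invFun := (toEnvelope α hα).continuous

end EnvelopeSmash

/-! ### Stability of restricted seminorms for the action of `U(𝔤)`. -/

section EnvelopingAction

variable {𝔤 : Type u} {A : Type v} [LieRing 𝔤] [LieAlgebra ℂ 𝔤] [Ring A]
    [Algebra ℂ A] [LieRingModule 𝔤 A] [LieModule ℂ 𝔤 A]

/-- A seminorm is stable under the enveloping algebra if all elements of the Lie algebra act by
bounded operators. -/
theorem seminormStable_envelopingAction (p : Seminorm ℂ A)
    (h : ∀ x : 𝔤, ∃ C : ℝ, 0 < C ∧ ∀ a : A, p ⁅x, a⁆ ≤ C * p a) :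
    SeminormStable (envelopingAction 𝔤 A) p := by
  -- Bounds multiply under composition and add under sums, so the elements acting boundedly form a
  -- subalgebra; it contains the generators from `𝔤` and is therefore everything.
  let S : Subalgebra ℂ (UniversalEnvelopingAlgebra ℂ 𝔤) :=
    { carrier := {u | ∃ C : ℝ, 0 < C ∧ ∀ a, p (envelopingAction 𝔤 A u a) ≤ C * p a}
      mul_mem' := by
        rintro u v ⟨C, hC, hu⟩ ⟨D, hD, hv⟩
        refine ⟨C * D, mul_pos hC hD, fun a => ?_⟩
        rw [map_mul, Module.End.mul_apply, mul_assoc]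
        exact (hu _).trans (mul_le_mul_of_nonneg_left (hv a) hC.le)
      add_mem' := by
        rintro u v ⟨C, hC, hu⟩ ⟨D, hD, hv⟩
        refine ⟨C + D, add_pos hC hD, fun a => ?_⟩
        rw [map_add, LinearMap.add_apply, add_mul]
        exact (map_add_le_add p _ _).trans (add_le_add (hu a) (hv a))
      algebraMap_mem' := fun c => by
        -- The summand `1` keeps the constant positive when `c = 0`.
        refine ⟨‖c‖ + 1, by positivity, fun a => ?_⟩
        rw [AlgHom.commutes, Module.algebraMap_end_apply, map_smul_eq_mul]
        exact mul_le_mul_of_nonneg_right (by linarith) (apply_nonneg p a) }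
  exact UniversalEnvelopingAlgebra.mem_subalgebra S fun x => by
    obtain ⟨C, hC, hx⟩ := h x
    exact ⟨C, hC, fun a => by rw [envelopingAction_ι]; exact hx a⟩

variable [ActsByDerivations 𝔤 A]

/-- In `A # U(𝔤)`, the action of an element of `𝔤` on `A` is given by the commutator. -/
theorem SmashProduct.includeA_lie (x : 𝔤) (a : A) :
    includeA (envelopingAction 𝔤 A) ⁅x, a⁆ =
      includeH (envelopingAction 𝔤 A) (UniversalEnvelopingAlgebra.ι ℂ x) *
        includeA (envelopingAction 𝔤 A) a -
      includeA (envelopingAction 𝔤 A) a *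
        includeH (envelopingAction 𝔤 A) (UniversalEnvelopingAlgebra.ι ℂ x) := by
  rw [includeA_mul_includeH, eq_sub_iff_add_eq]
  refine Eq.symm ((of_tmul_mul _ 1 (UniversalEnvelopingAlgebra.ι ℂ x) (a ⊗ₜ[ℂ] 1)).trans ?_)
  -- Primitivity of `x` is what produces a commutator: the product of `1 ⊗ x` and `a ⊗ 1` has just
  -- the two terms `⁅x, a⁆ ⊗ 1` and `a ⊗ x`.
  have hΔ : Coalgebra.comul (R := ℂ) (UniversalEnvelopingAlgebra.ι ℂ x) =
      UniversalEnvelopingAlgebra.ι ℂ x ⊗ₜ[ℂ] 1 + 1 ⊗ₜ[ℂ] UniversalEnvelopingAlgebra.ι ℂ x :=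
    UniversalEnvelopingAlgebra.comulHom_ι 𝔤 x
  rw [map_one, Module.End.one_apply, leftH_tmul, hΔ, map_add, map_add, TensorProduct.map_tmul,
    TensorProduct.map_tmul]
  simp only [LinearMap.flip_apply, AlgHom.toLinearMap_apply, envelopingAction_ι, map_one,
    Module.End.one_apply, LinearMap.mulRight_apply, mul_one]
  rfl

/-- The action of `x` on `A` is an inner derivation of `A # U(𝔤)`, and a submultiplicative seminorm
bounds the commutator with `X` by `2 * s X`. Bounds on `𝔤` then propagate to all of `U(𝔤)`. This
supplies the hypothesis `hα` of `envelopeEquiv`. -/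
theorem seminormStable_comp_includeA (s : Seminorm ℂ (SmashProduct (envelopingAction 𝔤 A)))
    (hs : Submultiplicative s) : SeminormStable (envelopingAction 𝔤 A)
      (s.comp (SmashProduct.includeA (envelopingAction 𝔤 A))) := by
  refine seminormStable_envelopingAction _ fun x => ?_
  set X := SmashProduct.includeH (envelopingAction 𝔤 A) (UniversalEnvelopingAlgebra.ι ℂ x)
  have hX : 0 ≤ s X := apply_nonneg s X
  -- The factor `2` comes from the two terms of the commutator; the added `1` gives strict
  -- positivity even if `s X = 0`.
  refine ⟨2 * s X + 1, by positivity, fun a => ?_⟩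
  rw [Seminorm.comp_apply, Seminorm.comp_apply, SmashProduct.includeA_lie]
  set Y := SmashProduct.includeA (envelopingAction 𝔤 A) a
  have h1 := map_sub_le_add s (X * Y) (Y * X)
  have h2 := hs X Y
  have h3 := hs Y X
  have h4 : 0 ≤ s Y := apply_nonneg s Y
  linarith

end EnvelopingAction

theorem mainTheorem4 {𝔤 : Type u} {A : Type v} [LieRing 𝔤] [LieAlgebra ℂ 𝔤] [Ring A]
    [Algebra ℂ A] [LieRingModule 𝔤 A] [LieModule ℂ 𝔤 A] [ActsByDerivations 𝔤 A] :
    ∃ e : ArensMichaelEnvelope (SmashProduct (envelopingAction 𝔤 A)) ≃A[ℂ]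
        EnvelopeSmash (envelopingAction 𝔤 A),
      ∀ x : SmashProduct (envelopingAction 𝔤 A),
        e (ArensMichaelEnvelope.ι (SmashProduct (envelopingAction 𝔤 A)) x) =
          EnvelopeSmash.canonical (envelopingAction 𝔤 A) x := by
  exact ⟨EnvelopeSmash.envelopeEquiv _ seminormStable_comp_includeA, fun x =>
    EnvelopeSmash.fromEnvelope_ι _ x⟩
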